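/- Let $n\ge 1$, let $M_n=M_n(\mathbb C)$, let $D_n\subseteq M_n$ be the subalgebra of diagonal matrices, and let $\mathrm{Aut}(M_n,D_n)$ be the topological group (with the topology of pointwise convergence) of all $*$-automorphisms $\varphi$ of $M_n$ with $\varphi(D_n)=D_n$. Let $T$ be a locally compact Hausdorff space and let $A$ be an $n$-homogeneous C*-algebra over $T$, that is, a C*-algebra all of whose irreducible representations have dimension $n$, together with a homeomorphism $t\mapsto I_t$ from $T$ onto the primitive ideal space of $A$ with the hull-kernel topology. A Cartan subalgebra of $A$ is an abelian sub-C*-algebra $B\subseteq A$ that contains an approximate unit of $A$, is maximal abelian, is regular (the set of all $x\in A$ with $xBx^*\subseteq B$ and $x^*Bx\subseteq B$ generates $A$ as a C*-algebra), and is the range of a faithful conditional expectation $A\to B$. For a Cartan subalgebra $B$, let $\beta_B$ be the space of all pairs $(t,\varphi)$ where $t\in T$ and $\varphi:A\to M_n$ is a surjective $*$-homomorphism with kernel $I_t$ and $\varphi(B)=D_n$ (equivalently, an isomorphism from the fibre $A/I_t$ to $M_n$ that maps the fibre of $B$ onto $D_n$), with the topology of convergence of $t$ in $T$ and of $\varphi(a)$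 in $M_n$ for each $a\in A$, the projection $(t,\varphi)\mapsto t$, and the action of $\mathrm{Aut}(M_n,D_n)$ by composition. Let $B_1$ and $B_2$ be Cartan subalgebras of $A$. Then $\beta_1=\beta_{B_1}$ and $\beta_2=\beta_{B_2}$ are locally trivial principal $\mathrm{Aut}(M_n,D_n)$-bundles over $T$. Moreover, there is a $*$-automorphism $\Phi$ of $A$ with $\Phi(B_1)=B_2$ (that is, $(A,B_1)\cong(A,B_2)$) if and only if $\beta_1\cong\beta_2$ as principal $\mathrm{Aut}(M_n,D_n)$-bundles, where an isomorphism of principal bundles is an equivariant homeomorphism of the total spaces covering a homeomorphism of $T$ that need not be the identity. -/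

import Mathlib

open Topology

universe u v

noncomputable section

namespace HomCartan

/-! ### Representations, primitive ideals, homogeneous C*-algebras -/

section Representations

variable {A : Type u} [NonUnitalCStarAlgebra A]

/-- A `*`-representation on a Hilbert space is irreducible if it is nonzero and has no closed
invariant subspaces besides the trivial ones. -/
structure IsIrreducibleRep {H : Type u} [NormedAddCommGroup H] [InnerProductSpace ℂ H]
    [CompleteSpace H] (π : A →⋆ₙₐ[ℂ] (H →L[ℂ] H)) : Prop where
  ne_zero : π ≠ 0
  eq_bot_or_eq_top : ∀ K : Submodule ℂ H, IsClosed (K : Set H) →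
    (∀ (a : A), ∀ v ∈ K, π a v ∈ K) → K = ⊥ ∨ K = ⊤

variable (A) in
/-- `A` is `n`-homogeneous if all its irreducible representations have dimension `n`.
(Irreducible representations are cyclic, so Hilbert spaces in the universe of `A` suffice.) -/
def IsHomogeneous (n : ℕ) : Prop :=
  ∀ (H : Type u) [NormedAddCommGroup H] [InnerProductSpace ℂ H] [CompleteSpace H]
    (π : A →⋆ₙₐ[ℂ] (H →L[ℂ] H)), IsIrreducibleRep π → Module.finrank ℂ H = n

/-- A primitive ideal is the kernel of an irreducible representation. -/
def IsPrimitiveIdeal (I : TwoSidedIdeal A) : Prop :=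
  ∃ (H : Type u) (_ : NormedAddCommGroup H) (_ : InnerProductSpace ℂ H) (_ : CompleteSpace H)
    (π : A →⋆ₙₐ[ℂ] (H →L[ℂ] H)), IsIrreducibleRep π ∧ I = TwoSidedIdeal.ker π

variable (A) in
/-- The primitive ideal space of `A`. For an `n`-homogeneous C*-algebra this is its spectrum. -/
def PrimitiveSpectrum : Type u := {I : TwoSidedIdeal A // IsPrimitiveIdeal I}

/-- The hull-kernel (Jacobson) topology: the closed sets are the hulls `{P | S ⊆ P}` of subsets
`S` of `A`, that is, the intersections of the sets `{P | a ∈ P}`. -/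
instance : TopologicalSpace (PrimitiveSpectrum A) :=
  TopologicalSpace.generateFrom (Set.range fun a : A => {P : PrimitiveSpectrum A | a ∉ P.1})

end Representations

/-! ### Cartan subalgebras -/

section Cartan

variable {A : Type u} [NonUnitalCStarAlgebra A]

/-- `E` is a conditional expectation of `A` onto `B`: a positive contractive linear projection
of `A` onto `B` that is a `B`-bimodule map. -/
structure IsConditionalExpectation (B : NonUnitalStarSubalgebra ℂ A) (E : A →ₗ[ℂ] A) : Prop where
  map_mem : ∀ a, E a ∈ B
  map_of_mem : ∀ b ∈ B, E b = b
  map_mul_mul : ∀ b ∈ B, ∀ b' ∈ B, ∀ a, E (b * a * b') = b * E a * b'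
  positive : ∀ a, ∃ c : A, E (star a * a) = star c * c
  contractive : ∀ a, ‖E a‖ ≤ ‖a‖

/-- The normalizer `{x | x B x* ⊆ B and x* B x ⊆ B}` of `B` in `A`. -/
def normalizer (B : NonUnitalStarSubalgebra ℂ A) : Set A :=
  {x | ∀ b ∈ B, x * b * star x ∈ B ∧ star x * b * x ∈ B}

/-- Cartan subalgebras: closed abelian `*`-subalgebras that contain an approximate unit of `A`,
are maximal abelian (equal to their relative commutant), regular (their normalizer generates `A`
as a C*-algebra), and the image of a faithful conditional expectation. -/
structure IsCartanSubalgebra (B : NonUnitalStarSubalgebra ℂ A) : Prop where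
  isClosed : IsClosed (B : Set A)
  approximateUnit : ∃ l : Filter A, l.IsApproximateUnit ∧ (B : Set A) ∈ l
  maximalAbelian : ∀ a : A, a ∈ B ↔ ∀ b ∈ B, a * b = b * a
  regular : closure (NonUnitalStarAlgebra.adjoin ℂ (normalizer B) : Set A) = Set.univ
  expectation : ∃ E : A →ₗ[ℂ] A, IsConditionalExpectation B E ∧ ∀ a, E (star a * a) = 0 → a = 0

/-- `(A₁, B₁) ≅ (A₂, B₂)`: there is an isomorphism of C*-algebras `A₁ → A₂` mapping `B₁`
onto `B₂`. -/
def PairIso {A₁ A₂ : Type*} [NonUnitalCStarAlgebra A₁] [NonUnitalCStarAlgebra A₂]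
    (B₁ : NonUnitalStarSubalgebra ℂ A₁) (B₂ : NonUnitalStarSubalgebra ℂ A₂) : Prop :=
  ∃ φ : A₁ ≃⋆ₐ[ℂ] A₂, φ '' (B₁ : Set A₁) = (B₂ : Set A₂)

end Cartan

/-! ### Principal bundles -/

section Bundles

/-- `p : E → T` is a (locally trivial) principal `G`-bundle. The structure group is written as
acting on the left of the total space; a right action is turned into a left one by inversion. -/
structure IsPrincipalBundle (G : Type*) [Group G] [TopologicalSpace G] [IsTopologicalGroup G]
    {E T : Type*} [TopologicalSpace E] [TopologicalSpace T] [MulAction G E] (p : E → T) :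
    Prop where
  map_smul : ∀ (g : G) (x : E), p (g • x) = p x
  locallyTrivial : ∀ t : T, ∃ e : Bundle.Trivialization G p, t ∈ e.baseSet ∧
    ∀ (g : G) (x : E), p x ∈ e.baseSet → (e (g • x)).2 = g * (e x).2

/-- Isomorphism of principal `G`-bundles, allowed to induce a nontrivial homeomorphism of the
base. -/
def PrincipalBundleIso (G : Type*) [Group G] {E₁ E₂ T₁ T₂ : Type*}
    [TopologicalSpace E₁] [TopologicalSpace E₂] [TopologicalSpace T₁] [TopologicalSpace T₂]
    [MulAction G E₁] [MulAction G E₂] (p₁ : E₁ → T₁) (p₂ : E₂ → T₂) : Prop :=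
  ∃ (F : E₁ ≃ₜ E₂) (f : T₁ ≃ₜ T₂), (∀ x, p₂ (F x) = f (p₁ x)) ∧
    ∀ (g : G) (x : E₁), F (g • x) = g • F x

end Bundles

/-! ### The group `Aut(Mₙ, Dₙ)` -/

section Aut

/-- The C*-algebra `Mₙ` of complex `n × n` matrices. -/
abbrev M (n : ℕ) : Type := Matrix (Fin n) (Fin n) ℂ

/-- The set `Dₙ` of diagonal matrices. -/
def diag (n : ℕ) : Set (M n) := {x | x.IsDiag}

/-- The group `Aut(Mₙ, Dₙ)` of the `*`-automorphisms `φ` of `Mₙ` with `φ(Dₙ) = Dₙ`. -/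
def autMD (n : ℕ) : Subgroup (M n ≃⋆ₐ[ℂ] M n) where
  carrier := {φ | φ '' diag n = diag n}
  mul_mem' := by
    intro φ ψ hφ hψ
    have : (⇑(φ * ψ) : M n → M n) = φ ∘ ψ := rfl
    simp only [Set.mem_ofPred_eq] at *
    rw [this, Set.image_comp, hψ, hφ]
  one_mem' := by
    have : (⇑(1 : M n ≃⋆ₐ[ℂ] M n) : M n → M n) = id := rfl
    simp [this]
  inv_mem' := by
    intro φ hφ
    have : (⇑(φ⁻¹) : M n → M n) ∘ φ = id := funext fun x => φ.symm_apply_apply x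
    simp only [Set.mem_ofPred_eq] at *
    conv_lhs => rw [← hφ]
    rw [← Set.image_comp, this, Set.image_id]

/-- The topology of pointwise convergence. As `Mₙ` is finite dimensional, it is also the norm
topology. -/
instance (n : ℕ) : TopologicalSpace (autMD n) :=
  TopologicalSpace.induced (fun (φ : autMD n) (x : M n) => φ.1 x) inferInstance

theorem autMD_continuous_apply (n : ℕ) (x : M n) : Continuous fun φ : autMD n => φ.1 x :=
  (continuous_apply x).comp continuous_induced_dom

theorem autMD_continuous_iff {n : ℕ} {X : Type*} [TopologicalSpace X] {f : X → autMD n} :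
    Continuous f ↔ ∀ x : M n, Continuous fun s => (f s).1 x :=
  continuous_induced_rng.trans continuous_pi_iff

/-- The matrix of `φ` as a linear map in the basis of matrix units. -/
def autMat {n : ℕ} (φ : autMD n) : Matrix (Fin n × Fin n) (Fin n × Fin n) ℂ :=
  Matrix.of fun p q => φ.1 (Matrix.single q.1 q.2 1) p.1 p.2

theorem autMD_apply {n : ℕ} (φ : autMD n) (x : M n) (p : Fin n × Fin n) :
    φ.1 x p.1 p.2 = (autMat φ).mulVec (fun q => x q.1 q.2) p := by
  conv_lhs => rw [Matrix.matrix_eq_sum_single x]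
  have h : ∀ i j, Matrix.single i j (x i j) = x i j • Matrix.single i j (1 : ℂ) := by
    intro i j; simp
  simp only [h, map_sum, map_smul, Matrix.sum_apply, Matrix.smul_apply, smul_eq_mul,
    Matrix.mulVec, dotProduct, autMat, Matrix.of_apply, Fintype.sum_prod_type]
  exact Finset.sum_congr rfl fun i _ => Finset.sum_congr rfl fun j _ => mul_comm _ _

theorem autMat_inv_mul {n : ℕ} (φ : autMD n) : autMat φ⁻¹ * autMat φ = 1 := by
  ext p q
  have h := autMD_apply φ⁻¹ (φ.1 (Matrix.single q.1 q.2 1)) p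
  have h' : (φ⁻¹).1 (φ.1 (Matrix.single q.1 q.2 1)) = Matrix.single q.1 q.2 1 :=
    φ.1.symm_apply_apply _
  rw [h'] at h
  change (autMat φ⁻¹).mulVec (fun r => autMat φ r q) p = _
  have : (fun r => autMat φ r q) = fun r => φ.1 (Matrix.single q.1 q.2 1) r.1 r.2 := rfl
  rw [this, ← h]
  simp [Matrix.single_apply, Matrix.one_apply, Prod.ext_iff, eq_comm]

theorem continuous_autMat (n : ℕ) : Continuous (autMat : autMD n → _) :=
  continuous_matrix fun p q =>
    (autMD_continuous_apply n (Matrix.single q.1 q.2 1)).matrix_elem p.1 p.2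

theorem autMD_continuous_of_autMat {n : ℕ} {X : Type*} [TopologicalSpace X] {f : X → autMD n}
    (hf : Continuous fun s => autMat (f s)) : Continuous f := by
  rw [autMD_continuous_iff]
  intro x
  refine continuous_matrix fun i j => ?_
  simp only [fun s => autMD_apply (f s) x (i, j)]
  exact (continuous_pi_iff.1 (hf.matrix_mulVec continuous_const)) (i, j)

instance (n : ℕ) : IsTopologicalGroup (autMD n) where
  continuous_mul := by
    refine autMD_continuous_of_autMat ?_
    have : (fun s : autMD n × autMD n => autMat (s.1 * s.2)) =
        fun s => autMat s.1 * autMat s.2 := by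
      funext s
      ext p q
      exact autMD_apply s.1 (s.2.1 (Matrix.single q.1 q.2 1)) p
    rw [this]
    exact ((continuous_autMat n).comp continuous_fst).matrix_mul
      ((continuous_autMat n).comp continuous_snd)
  continuous_inv := by
    refine autMD_continuous_of_autMat ?_
    have : (fun φ : autMD n => autMat φ⁻¹) =
        fun φ => (autMat φ).det⁻¹ • (autMat φ).adjugate := by
      funext φ
      rw [← Ring.inverse_eq_inv', ← Matrix.inv_def]
      exact (Matrix.inv_eq_left_inv (autMat_inv_mul φ)).symm
    rw [this]
    refine Continuous.smul (Continuous.inv₀ (continuous_autMat n).matrix_det fun φ h => ?_)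
      (continuous_autMat n).matrix_adjugate
    have := congrArg Matrix.det (autMat_inv_mul φ)
    simp [h] at this

end Aut

/-! ### The principal bundle of a Cartan subalgebra -/

section Frames

variable {A : Type u} [NonUnitalCStarAlgebra A] {T : Type v} [TopologicalSpace T]

/-- Let `A` be a C*-algebra with primitive ideal space `T`, and `B` a `*`-subalgebra. The fibre
over `t` of the C*-bundle of `A` is the quotient of `A` by the primitive ideal `t`, and the fibre
of the bundle of `B` is the image of `B` in it. A point over `t` of the total space of the
associated bundle consists of an isomorphism from the fibre at `t` to `Mₙ` that maps the fibre of
`B` onto `Dₙ`; it is given here as a surjection `A → Mₙ` with kernel `t`. -/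
@[ext]
structure Frame (θ : T ≃ₜ PrimitiveSpectrum A) (n : ℕ) (B : NonUnitalStarSubalgebra ℂ A) where
  base : T
  hom : A →⋆ₙₐ[ℂ] M n
  ker_hom : TwoSidedIdeal.ker hom = (θ base).1
  surjective : Function.Surjective hom
  image_eq : hom '' (B : Set A) = diag n

variable {θ : T ≃ₜ PrimitiveSpectrum A} {n : ℕ} {B : NonUnitalStarSubalgebra ℂ A}

/-- The total space has the topology of convergence in the base together with convergence in `Mₙ`
on all sections, that is, on all elements of `A`. -/
instance : TopologicalSpace (Frame θ n B) :=
  TopologicalSpace.induced (fun x => (x.base, fun a : A => x.hom a)) inferInstance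

/-- `Aut(Mₙ, Dₙ)` acts on the total space by composition. -/
instance : MulAction (autMD n) (Frame θ n B) where
  smul g x :=
    { base := x.base
      hom := g.1.toNonUnitalStarAlgHom.comp x.hom
      ker_hom := by
        rw [← x.ker_hom]
        ext a
        simp only [TwoSidedIdeal.mem_ker]
        exact map_eq_zero_iff g.1 g.1.injective
      surjective := g.1.surjective.comp x.surjective
      image_eq := by
        change (fun a => g.1 (x.hom a)) '' (B : Set A) = diag n
        rw [← Set.image_image, x.image_eq]
        exact g.2 }
  one_smul _ := rfl
  mul_smul _ _ _ := rfl

variable (θ n B) in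
/-- The projection of the bundle associated with `B`. -/
def frameProj (x : Frame θ n B) : T := x.base

end Frames

end HomCartan

end

/-!
The points of `T` are the surjections `A → Mₙ` up to unitary equivalence, and compactly supported
continuous functions on `T` act on `A` as central elements. These lie in `B`, so the conditional
expectation onto `B` commutes with localization over `T` and acts on the fibres of `A`. Hence the
fibres of `B` are maximal abelian, and therefore conjugate to `Dₙ`. Lifting the matrix units of a
fibre to a neighbourhood, with the diagonal ones in `B`, gives a local section of `β_B`.

An isomorphism of pairs acts on the frames by composition. Conversely, an equivariant
homeomorphism `G : β₁ → β₂` turns `b ∈ A` into the equivariant function `x ↦ G(x)(b)` on `β₁`. This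
is a continuous section of the bundle of `A` that vanishes at infinity, and by a partition of unity
and completeness it comes from an element of `A`.
-/

noncomputable section

namespace HomCartan

/-! ### Existence of irreducible representations -/

section PureStates

open scoped ComplexOrder InnerProductSpace

section InvariantSubspaces

variable {𝕜 H : Type*} [RCLike 𝕜] [NormedAddCommGroup H] [InnerProductSpace 𝕜 H]
  [CompleteSpace H]

theorem apply_mem_orthogonal {T : H →L[𝕜] H} {K : Submodule 𝕜 H}
    (hK : ∀ v ∈ K, star T v ∈ K) : ∀ v ∈ Kᗮ, T v ∈ Kᗮ := by
  intro v hv w hw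
  rw [← ContinuousLinearMap.adjoint_inner_left, ← ContinuousLinearMap.star_eq_adjoint]
  exact hv _ (hK w hw)

theorem starProjection_apply_comm {T : H →L[𝕜] H} {K : Submodule 𝕜 H} [K.HasOrthogonalProjection]
    (hK : ∀ v ∈ K, T v ∈ K) (hK' : ∀ v ∈ K, star T v ∈ K) (v : H) :
    K.starProjection (T v) = T (K.starProjection v) := by
  refine Submodule.eq_starProjection_of_mem_orthogonal
    (hK _ (Submodule.starProjection_apply_mem K v)) ?_
  rw [← map_sub]
  exact apply_mem_orthogonal hK' _ (Submodule.sub_starProjection_mem_orthogonal v)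

end InvariantSubspaces

section VectorStates

variable {C : Type*} [CStarAlgebra C] {H : Type*} [NormedAddCommGroup H] [InnerProductSpace ℂ H]
  [CompleteSpace H] (π : C →⋆ₐ[ℂ] (H →L[ℂ] H))

/-- The functional `x ↦ ⟪ξ, π x ξ⟫` defined by a vector `ξ` of a representation `π`; it is a state
if `ξ` is a unit vector. -/
def vectorState (ξ : H) : WeakDual ℂ C :=
  StrongDual.toWeakDual <| innerSL ℂ ξ ∘L ContinuousLinearMap.apply ℂ H ξ ∘L
    LinearMap.mkContinuous π.toLinearMap 1 fun x => by
      simpa using NonUnitalStarAlgHom.norm_apply_le π x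

theorem vectorState_apply (ξ : H) (x : C) : vectorState π ξ x = ⟪ξ, π x ξ⟫_ℂ := rfl

theorem vectorState_smul (c : ℂ) (ξ : H) :
    vectorState π (c • ξ) = (‖c‖ ^ 2 : ℝ) • vectorState π ξ := by
  refine DFunLike.ext _ _ fun x => ?_
  change ⟪c • ξ, π x (c • ξ)⟫_ℂ = (‖c‖ ^ 2 : ℝ) • ⟪ξ, π x ξ⟫_ℂ
  rw [map_smul, inner_smul_left, inner_smul_right, ← mul_assoc, Complex.conj_mul',
    Complex.real_smul, Complex.ofReal_pow]

theorem norm_vectorState_apply_le (ξ : H) (x : C) : ‖vectorState π ξ x‖ ≤ ‖ξ‖ ^ 2 * ‖x‖ :=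
  calc ‖⟪ξ, π x ξ⟫_ℂ‖ ≤ ‖ξ‖ * ‖π x ξ‖ := norm_inner_le_norm _ _
    _ ≤ ‖ξ‖ * (‖x‖ * ‖ξ‖) := by
      gcongr
      exact (π x).le_of_opNorm_le (NonUnitalStarAlgHom.norm_apply_le π x) ξ
    _ = ‖ξ‖ ^ 2 * ‖x‖ := by ring

variable {π}

theorem vectorState_eq_add_of_invariant {K : Submodule ℂ H} [K.HasOrthogonalProjection]
    (hK : ∀ x, ∀ v ∈ K, π x v ∈ K) (ξ : H) :
    vectorState π ξ = vectorState π (K.starProjection ξ) + vectorState π (Kᗮ.starProjection ξ) := by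
  refine DFunLike.ext _ _ fun x => ?_
  set v := K.starProjection ξ
  set w := Kᗮ.starProjection ξ
  have hxv : π x v ∈ K := hK x v (K.starProjection_apply_mem ξ)
  have hxw : π x w ∈ Kᗮ := apply_mem_orthogonal (fun v hv => by rw [← map_star]; exact hK _ v hv)
    w (Kᗮ.starProjection_apply_mem ξ)
  have hξ : ξ = v + w := (K.starProjection_add_starProjection_orthogonal ξ).symm
  change ⟪ξ, π x ξ⟫_ℂ = ⟪v, π x v⟫_ℂ + ⟪w, π x w⟫_ℂ
  rw [hξ, map_add, inner_add_left, inner_add_right, inner_add_right,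
    K.inner_right_of_mem_orthogonal (K.starProjection_apply_mem ξ) hxw,
    K.inner_left_of_mem_orthogonal hxv (Kᗮ.starProjection_apply_mem ξ), add_zero, zero_add]

theorem eq_top_of_mem_of_denseRange {ξ : H} (hcyc : DenseRange fun x => π x ξ)
    {K : Submodule ℂ H} (hK : IsClosed (K : Set H)) (hinv : ∀ x, ∀ v ∈ K, π x v ∈ K)
    (hξ : ξ ∈ K) : K = ⊤ := by
  have hdense : Dense (K : Set H) := hcyc.mono <| Set.range_subset_iff.2 fun x => hinv x ξ hξ
  exact SetLike.coe_injective (hK.closure_eq ▸ hdense.closure_eq)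

variable [PartialOrder C] [StarOrderedRing C]

variable (C) in
/-- The state space of a unital C*-algebra, with the weak-* topology. -/
def stateSpace : Set (WeakDual ℂ C) := {f | (∀ x, 0 ≤ x → 0 ≤ f x) ∧ f 1 = 1}

theorem vectorState_mem_stateSpace {ξ : H} (hξ : ‖ξ‖ = 1) : vectorState π ξ ∈ stateSpace C := by
  refine ⟨fun x hx => ?_, ?_⟩
  · obtain ⟨y, rfl⟩ := CStarAlgebra.nonneg_iff_eq_star_mul_self.1 hx
    rw [vectorState_apply, map_mul, map_star, mul_apply_eq_comp,
      ContinuousLinearMap.star_eq_adjoint, ContinuousLinearMap.adjoint_inner_right,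
      inner_self_eq_norm_sq_to_K]
    exact pow_nonneg (RCLike.ofReal_nonneg.2 (norm_nonneg _)) 2
  · rw [vectorState_apply, map_one, one_apply_eq_self, inner_self_eq_norm_sq_to_K, hξ]
    simp only [map_one, one_pow]

theorem exists_mem_stateSpace_smul_eq_vectorState {ξ : H} (hξ : ξ ≠ 0) :
    ∃ f ∈ stateSpace C, vectorState π ξ = (‖ξ‖ ^ 2 : ℝ) • f := by
  have hnorm : ‖ξ‖ ≠ 0 := norm_ne_zero_iff.2 hξ
  obtain ⟨η, hη, hξη⟩ : ∃ η : H, ‖η‖ = 1 ∧ ξ = (‖ξ‖ : ℂ) • η :=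
    ⟨(‖ξ‖ : ℂ)⁻¹ • ξ, norm_smul_inv_norm hξ, by
      rw [smul_inv_smul₀ (Complex.ofReal_ne_zero.2 hnorm)]⟩
  refine ⟨vectorState π η, vectorState_mem_stateSpace hη, ?_⟩
  conv_lhs => rw [hξη, vectorState_smul, Complex.norm_real, norm_norm]

/-- If `ξ` had nonzero components in `K` and in `Kᗮ`, its state would be a proper convex combination
of their normalized states, so it would agree with the state of the component in `K`; as `ξ` is
cyclic, this puts `ξ` into `K`. -/
theorem eq_bot_or_eq_top_of_pure {ξ : H} (hξ : ‖ξ‖ = 1) (hcyc : DenseRange fun x => π x ξ)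
    (hpure : vectorState π ξ ∈ (stateSpace C).extremePoints ℝ) {K : Submodule ℂ H}
    (hK : IsClosed (K : Set H)) (hinv : ∀ x, ∀ v ∈ K, π x v ∈ K) : K = ⊥ ∨ K = ⊤ := by
  have : CompleteSpace K := hK.completeSpace_coe
  have hinv_star (x : C) : ∀ v ∈ K, star (π x) v ∈ K := fun v hv => by
    rw [← map_star]; exact hinv _ v hv
  have hξK_top : ξ ∈ K → K = ⊤ := eq_top_of_mem_of_denseRange hcyc hK hinv
  set v := K.starProjection ξ with hv
  set w := Kᗮ.starProjection ξ
  have hvK : v ∈ K := K.starProjection_apply_mem ξ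
  have hvw : v + w = ξ := K.starProjection_add_starProjection_orthogonal ξ
  obtain hv0 | hv0 := eq_or_ne v 0
  · have hξ' : ξ ∈ Kᗮ := by
      rw [← hvw, hv0, zero_add]; exact Kᗮ.starProjection_apply_mem ξ
    have := eq_top_of_mem_of_denseRange hcyc K.isClosed_orthogonal
      (fun x => apply_mem_orthogonal (hinv_star x)) hξ'
    exact .inl (K.orthogonal_eq_top_iff.1 this)
  obtain hw0 | hw0 := eq_or_ne w 0
  · exact .inr <| hξK_top <| by rwa [← hvw, hw0, add_zero]
  obtain ⟨f, hf, hvf⟩ := exists_mem_stateSpace_smul_eq_vectorState (π := π) hv0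
  obtain ⟨g, hg, hwg⟩ := exists_mem_stateSpace_smul_eq_vectorState (π := π) hw0
  have hsum : ‖v‖ ^ 2 + ‖w‖ ^ 2 = 1 := by
    rw [← Submodule.norm_sq_eq_add_norm_sq_starProjection, hξ, one_pow]
  have hf_eq : f = vectorState π ξ := hpure.2 hf hg
    ⟨‖v‖ ^ 2, ‖w‖ ^ 2, by positivity, by positivity, hsum, by
      rw [← hvf, ← hwg, ← vectorState_eq_add_of_invariant hinv]⟩
  have hv_eq : v - ((‖v‖ ^ 2 : ℝ) : ℂ) • ξ = 0 := by
    refine hcyc.eq_zero_of_inner_left ℂ fun x : C => ?_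
    have hstate : ⟪v, π x v⟫_ℂ = ((‖v‖ ^ 2 : ℝ) : ℂ) * ⟪ξ, π x ξ⟫_ℂ := by
      have := congr($hvf x)
      rwa [hf_eq] at this
    have hproj : ⟪v, π x v⟫_ℂ = ⟪v, π x ξ⟫_ℂ := by
      rw [hv, ← starProjection_apply_comm (hinv x) (hinv_star x),
        ← Submodule.inner_starProjection_left_eq_right,
        Submodule.starProjection_eq_self_iff.2 hvK]
    rw [inner_sub_left, inner_smul_left, Complex.conj_ofReal, ← hstate, hproj, sub_self]
  refine .inr <| hξK_top ?_
  have hnorm : ((‖v‖ ^ 2 : ℝ) : ℂ) ≠ 0 := by exact_mod_cast (by positivity : ‖v‖ ^ 2 ≠ 0)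
  rwa [sub_eq_zero.1 hv_eq, K.smul_mem_iff hnorm] at hvK

end VectorStates

section States

variable {C : Type u} [CStarAlgebra C] [PartialOrder C] [StarOrderedRing C]

/-- The GNS construction. -/
theorem exists_eq_vectorState {f : WeakDual ℂ C} (hf : f ∈ stateSpace C) :
    ∃ (H : Type u) (_ : NormedAddCommGroup H) (_ : InnerProductSpace ℂ H) (_ : CompleteSpace H)
      (π : C →⋆ₐ[ℂ] (H →L[ℂ] H)) (ξ : H),
      ‖ξ‖ = 1 ∧ (DenseRange fun x => π x ξ) ∧ f = vectorState π ξ := by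
  let p : C →ₚ[ℂ] ℂ := PositiveLinearMap.mk₀ (f : C →L[ℂ] ℂ).toLinearMap hf.1
  let ξ : p.GNS := ((p.toPreGNS 1 : p.PreGNS) : p.GNS)
  have hξ (x : C) : p.gnsStarAlgHom x ξ = ((p.toPreGNS x : p.PreGNS) : p.GNS) := by
    change p.gnsNonUnitalStarAlgHom x ξ = _
    rw [PositiveLinearMap.gnsNonUnitalStarAlgHom_apply_coe]
    simp
  have hinner (x : C) : f x = ⟪ξ, p.gnsStarAlgHom x ξ⟫_ℂ := by
    rw [hξ, UniformSpace.Completion.inner_coe, PositiveLinearMap.preGNS_inner_def]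
    simp [p]
    rfl
  refine ⟨p.GNS, inferInstance, inferInstance, inferInstance, p.gnsStarAlgHom, ξ, ?_, ?_,
    DFunLike.ext _ _ hinner⟩
  · have h := hinner 1
    rw [hf.2, map_one, one_apply_eq_self, inner_self_eq_norm_sq_to_K] at h
    exact (pow_eq_one_iff_of_nonneg (norm_nonneg ξ) two_ne_zero).1 
      (RCLike.ofReal_injective (K := ℂ) (by simpa using h.symm))
  · rw [funext hξ]
    exact UniformSpace.Completion.denseRange_coe.comp p.toPreGNS.surjective.denseRange
      (UniformSpace.Completion.continuous_coe _)

theorem isCompact_stateSpace : IsCompact (stateSpace C) := by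
  refine (WeakDual.isCompact_closedBall (0 : StrongDual ℂ C) 1).of_isClosed_subset ?_ ?_
  · simp only [stateSpace, Set.ofPred_and, Set.ofPred_forall]
    exact (isClosed_iInter fun x => isClosed_iInter fun _ =>
      isClosed_le continuous_const (WeakDual.eval_continuous x)).inter
      (isClosed_eq (WeakDual.eval_continuous 1) continuous_const)
  · intro f hf
    obtain ⟨H, _, _, _, π, ξ, hξ, -, rfl⟩ := exists_eq_vectorState hf
    rw [Set.mem_preimage, mem_closedBall_zero_iff]
    exact ContinuousLinearMap.opNorm_le_bound _ zero_le_one fun x => by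
      simpa [hξ] using norm_vectorState_apply_le π ξ x

/-- The functional separates `-x` from the positive cone. -/
theorem exists_positive_apply_pos {x : C} (hx : 0 < x) :
    ∃ f : C →L[ℂ] ℂ, (∀ y, 0 ≤ y → 0 ≤ f y) ∧ 0 < f x := by
  let P : ProperCone ℝ C :=
    { carrier := {y | 0 ≤ y}
      add_mem' := add_nonneg
      zero_mem' := le_refl (0 : C)
      smul_mem' := fun r _ hy => smul_nonneg (a := (r : ℝ)) r.2 hy
      isClosed' := isClosed_Ici }
  have hxP : -x ∉ P := fun h => hx.not_ge (neg_nonneg.1 h)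
  obtain ⟨g, hg, hgx⟩ := P.hyperplane_separation_point hxP
  let h : C →L[ℝ] ℝ := g + g ∘L (starL' ℝ : C ≃L[ℝ] C).toContinuousLinearMap
  have extend_apply {y : C} (hy : 0 ≤ y) :
      StrongDual.extendRCLike (𝕜 := ℂ) h y = (2 * g y : ℝ) := by
    have hhy (z : C) : h z = g z + g (star z) := rfl
    rw [StrongDual.extendRCLike_apply, hhy, hhy]
    simp [hy.isSelfAdjoint.star_eq, two_mul]
  refine ⟨StrongDual.extendRCLike h, fun y hy => ?_, ?_⟩
  · rw [extend_apply hy]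
    exact_mod_cast mul_nonneg zero_le_two (hg y hy)
  · rw [extend_apply hx.le]
    have : 0 < g x := by simpa only [map_neg, Left.neg_neg_iff] using hgx
    exact_mod_cast mul_pos zero_lt_two this

theorem exists_state_apply_pos {x : C} (hx : 0 < x) : ∃ f ∈ stateSpace C, 0 < f x := by
  obtain ⟨f, hf, hfx⟩ := exists_positive_apply_pos hx
  have hf1 : 0 < f 1 := by
    refine (hf 1 zero_le_one).lt_of_ne' fun h => ?_
    have hle : ‖f x‖ ≤ ‖f 1‖ * ‖x‖ :=
      PositiveLinearMap.norm_apply_le_of_nonneg (PositiveLinearMap.mk₀ f.toLinearMap hf) x hx.le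
    rw [h, norm_zero, zero_mul, norm_le_zero_iff] at hle
    exact hfx.ne' hle
  refine ⟨StrongDual.toWeakDual ((f 1)⁻¹ • f), ⟨fun y hy => ?_, inv_mul_cancel₀ hf1.ne'⟩, ?_⟩
  · exact mul_nonneg (inv_nonneg.2 hf1.le) (hf y hy)
  · exact mul_pos (inv_pos.2 hf1) hfx

/-- The states that maximize evaluation at `x` form a nonempty face of the state space, which has an
extreme point by the Krein-Milman lemma. -/
theorem exists_pure_state_apply_ne_zero {x : C} (hx : 0 < x) :
    ∃ f ∈ (stateSpace C).extremePoints ℝ, f x ≠ 0 := by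
  obtain ⟨f₀, hf₀, hf₀x⟩ := exists_state_apply_pos hx
  let ev : StrongDual ℝ (WeakDual ℂ C) :=
    { toFun f := (f x).re
      map_add' _ _ := rfl
      map_smul' c f := Complex.smul_re c (f x)
      cont := Complex.continuous_re.comp (WeakDual.eval_continuous x) }
  have hexp : IsExposed ℝ (stateSpace C) (ev.toExposed (stateSpace C)) :=
    ContinuousLinearMap.toExposed.isExposed
  have : LocallyConvexSpace ℝ (WeakDual ℂ C) :=
    inferInstanceAs (LocallyConvexSpace ℝ (WeakBilin (topDualPairing ℂ C)))
  obtain ⟨f₁, hf₁, hmax⟩ :=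
    isCompact_stateSpace.exists_isMaxOn ⟨f₀, hf₀⟩ ev.continuous.continuousOn
  obtain ⟨f, hf⟩ := (hexp.isCompact isCompact_stateSpace).extremePoints_nonempty ⟨f₁, hf₁, hmax⟩
  refine ⟨f, hexp.isExtreme.extremePoints_subset_extremePoints hf, fun h => ?_⟩
  have hle : (f₀ x).re ≤ (f x).re := hf.1.2 f₀ hf₀
  rw [h] at hle
  exact hle.not_gt (Complex.pos_iff.1 hf₀x).1

end States

theorem exists_isIrreducibleRep_apply_ne_zero {A : Type u} [NonUnitalCStarAlgebra A] {a : A}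
    (ha : a ≠ 0) :
    ∃ (H : Type u) (_ : NormedAddCommGroup H) (_ : InnerProductSpace ℂ H) (_ : CompleteSpace H)
      (π : A →⋆ₙₐ[ℂ] (H →L[ℂ] H)), IsIrreducibleRep π ∧ π a ≠ 0 := by
  let _ := CStarAlgebra.spectralOrder (Unitization ℂ A)
  have := CStarAlgebra.spectralOrderedRing (Unitization ℂ A)
  let ι := Unitization.inrNonUnitalStarAlgHom ℂ A
  have hpos : 0 < star (ι a) * ι a := (star_mul_self_nonneg _).lt_of_ne'
    ((CStarRing.star_mul_self_ne_zero_iff _).2 ((map_ne_zero_iff ι Unitization.inr_injective).2 ha))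
  obtain ⟨f, hf, hfa⟩ := exists_pure_state_apply_ne_zero hpos
  obtain ⟨H, i₁, i₂, i₃, π, ξ, hξ, hcyc, rfl⟩ := exists_eq_vectorState hf.1
  have hπa : π (ι a) ≠ 0 := fun h => hfa <| by
    rw [vectorState_apply, map_mul, h, mul_zero, zero_apply, inner_zero_right]
  refine ⟨H, i₁, i₂, i₃, (π : Unitization ℂ A →⋆ₙₐ[ℂ] (H →L[ℂ] H)).comp ι,
    ⟨fun h => hπa congr($h a), fun K hK hinv => ?_⟩, hπa⟩
  refine eq_bot_or_eq_top_of_pure hξ hcyc hf hK fun x v hv => ?_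
  induction x using Unitization.ind with
  | inl_add_inr c b =>
    have hc : (Unitization.inl c : Unitization ℂ A) = algebraMap ℂ _ c := rfl
    rw [map_add, add_apply, hc, AlgHomClass.commutes, Algebra.algebraMap_eq_smul_one]
    exact K.add_mem (K.smul_mem c hv) (hinv b v hv)

end PureStates

/-! ### Finite-dimensional representations of homogeneous C*-algebras -/

section FiniteDimensional

open scoped InnerProductSpace

section Burnside

variable {k : Type*} [Field k] [IsAlgClosed k]

/-- Burnside's theorem. -/
theorem surjective_of_irreducible {R V : Type*} [Ring R] [Algebra k R] [AddCommGroup V] [Module k V]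
    [FiniteDimensional k V] [Nontrivial V] (f : R →ₐ[k] Module.End k V)
    (hf : ∀ K : Submodule k V, (∀ r, ∀ v ∈ K, f r v ∈ K) → K = ⊥ ∨ K = ⊤) :
    Function.Surjective f := by
  let _ : Module R V := Module.compHom V f.toRingHom
  have hsmul (r : R) (v : V) : r • v = f r v := rfl
  have : IsScalarTower k R V := ⟨fun c r v => by simp [hsmul]⟩
  have : IsSimpleModule R V := (isSimpleModule_iff ..).2
    { eq_bot_or_eq_top := fun K =>
        (hf (K.restrictScalars k) fun r v hv => K.smul_mem r hv).imp
          (Submodule.restrictScalars_eq_bot_iff k R V).1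
          (Submodule.restrictScalars_eq_top_iff k R V).1 }
  intro x
  let F : Module.End (Module.End R V) V :=
    { toFun := x
      map_add' := map_add x
      map_smul' := fun g v => by
        obtain ⟨c, rfl⟩ := (IsSimpleModule.algebraMap_end_bijective_of_isAlgClosed k).2 g
        exact map_smul x c v }
  obtain ⟨s, hs⟩ := Module.Finite.fg_top (R := k) (M := V)
  obtain ⟨r, hr⟩ := jacobson_density F s
  exact ⟨r, LinearMap.ext_on hs fun v hv => (hr v hv).symm⟩

/-- By Burnside's theorem, the range of `φ` is a nonzero two-sided ideal. -/
theorem surjective_of_irreducible_of_ne_zero {R ι : Type*} [NonUnitalRing R] [Module k R]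
    [IsScalarTower k R R] [SMulCommClass k R R] [Fintype ι]
    {φ : R →ₙₐ[k] Matrix ι ι k} (h0 : φ ≠ 0)
    (hφ : ∀ K : Submodule k (ι → k), (∀ r, ∀ v ∈ K, (φ r).mulVec v ∈ K) → K = ⊥ ∨ K = ⊤) :
    Function.Surjective φ := by
  classical
  obtain ⟨r₀, hr₀⟩ : ∃ r, φ r ≠ 0 := DFunLike.ne_iff.1 h0
  obtain ⟨i, -⟩ : ∃ i, φ r₀ i ≠ 0 := Function.ne_iff.1 hr₀
  have : Nonempty ι := ⟨i⟩
  let ψ : Unitization k R →ₐ[k] Matrix ι ι k := Unitization.lift φ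
  have hψ_inr (r : R) : ψ r = φ r := by simp [ψ]
  have hψ : Function.Surjective ψ := by
    refine Function.Surjective.of_comp_left (f := Matrix.toLinAlgEquiv')
      (surjective_of_irreducible (Matrix.toLinAlgEquiv'.toAlgHom.comp ψ) fun K hK =>
        hφ K fun r v hv => ?_) Matrix.toLinAlgEquiv'.injective
    rw [← hψ_inr]
    exact hK r v hv
  let J : TwoSidedIdeal (Matrix ι ι k) := TwoSidedIdeal.mk' (Set.range φ) ⟨0, map_zero φ⟩
    (fun hx hy => by
      obtain ⟨⟨r, rfl⟩, ⟨s, rfl⟩⟩ := And.intro hx hy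
      exact ⟨r + s, map_add φ r s⟩)
    (fun hx => by
      obtain ⟨r, rfl⟩ := hx
      exact ⟨-r, map_neg φ r⟩)
    (fun {x y} hy => by
      obtain ⟨⟨r, rfl⟩, ⟨z, rfl⟩⟩ := And.intro hy (hψ x)
      exact ⟨(z * r).snd, by rw [← hψ_inr, ← hψ_inr, ← map_mul]; congr; ext <;> simp⟩)
    (fun {x y} hx => by
      obtain ⟨⟨r, rfl⟩, ⟨z, rfl⟩⟩ := And.intro hx (hψ y)
      exact ⟨(r * z).snd, by rw [← hψ_inr, ← hψ_inr, ← map_mul]; congr; ext <;> simp⟩)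
  intro x
  have := IsSimpleRing.one_mem_of_ne_zero_mem J hr₀ ((TwoSidedIdeal.mem_mk' ..).2 ⟨r₀, rfl⟩)
  have hx : x ∈ J := by simpa only [mul_one] using J.mul_mem_left x 1 this
  exact (TwoSidedIdeal.mem_mk' (Set.range φ) ..).1 hx

end Burnside

section Homogeneous

section Comp

variable {A C D : Type*} [NonUnitalRing A] [Module ℂ A] [StarRing A] [NonUnitalRing C] [Module ℂ C]
  [StarRing C] [NonUnitalRing D] [Module ℂ D] [StarRing D]

theorem comp_ne_zero (e : C ≃⋆ₐ[ℂ] D) {π : A →⋆ₙₐ[ℂ] C} (hπ : π ≠ 0) :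
    e.toNonUnitalStarAlgHom.comp π ≠ 0 := by
  obtain ⟨a, ha⟩ := DFunLike.ne_iff.1 hπ
  exact DFunLike.ne_iff.2 ⟨a, (map_ne_zero_iff e e.injective).2 ha⟩

theorem ker_comp (e : C ≃⋆ₐ[ℂ] D) (π : A →⋆ₙₐ[ℂ] C) :
    TwoSidedIdeal.ker (e.toNonUnitalStarAlgHom.comp π) = TwoSidedIdeal.ker π := by
  ext a
  simp only [TwoSidedIdeal.mem_ker]
  exact map_eq_zero_iff e e.injective

end Comp

variable {A : Type u} [NonUnitalCStarAlgebra A]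

/-- The Hilbert space has to be moved to the universe of `A`. -/
theorem exists_isIrreducibleRep_of_finiteDimensional {K : Type*} [NormedAddCommGroup K]
    [InnerProductSpace ℂ K] [FiniteDimensional ℂ K] {ρ : A →⋆ₙₐ[ℂ] (K →L[ℂ] K)} (h0 : ∃ a, ρ a ≠ 0)
    (hρ : ∀ L : Submodule ℂ K, (∀ a, ∀ v ∈ L, ρ a v ∈ L) → L = ⊥ ∨ L = ⊤) :
    ∃ (H : Type u) (_ : NormedAddCommGroup H) (_ : InnerProductSpace ℂ H) (_ : CompleteSpace H)
      (π : A →⋆ₙₐ[ℂ] (H →L[ℂ] H)), IsIrreducibleRep π ∧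
        Module.finrank ℂ H = Module.finrank ℂ K ∧ TwoSidedIdeal.ker π = TwoSidedIdeal.ker ρ := by
  have : CompleteSpace K := FiniteDimensional.complete ℂ K
  let e : K ≃ₗᵢ[ℂ] EuclideanSpace ℂ (ULift.{u} (Fin (Module.finrank ℂ K))) :=
    ((stdOrthonormalBasis ℂ K).reindex Equiv.ulift.symm).repr
  refine ⟨_, inferInstance, inferInstance, inferInstance,
    e.conjStarAlgEquiv.toNonUnitalStarAlgHom.comp ρ,
    ⟨comp_ne_zero _ (DFunLike.ne_iff.2 h0), fun L _ hL => ?_⟩, by simp, ker_comp _ ρ⟩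
  have hinv (a : A) : ∀ v ∈ L.comap (e.toLinearEquiv : K →ₗ[ℂ] _),
      ρ a v ∈ L.comap (e.toLinearEquiv : K →ₗ[ℂ] _) := fun v hv => by
    simpa using hL a (e v) hv
  refine (hρ _ hinv).imp (fun h => ?_) fun h => ?_
  · exact Submodule.comap_injective_of_surjective e.surjective (by simpa using h)
  · exact Submodule.comap_injective_of_surjective e.surjective (by simpa using h)

section Restriction

variable {H : Type*} [NormedAddCommGroup H] [InnerProductSpace ℂ H] [FiniteDimensional ℂ H]
  {π : A →⋆ₙₐ[ℂ] (H →L[ℂ] H)} {K : Submodule ℂ H}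

/-- The subrepresentation of a finite-dimensional representation on an invariant subspace. It is
written as a compression, so that `star` is mapped to `star`. -/
def restrictRep (π : A →⋆ₙₐ[ℂ] (H →L[ℂ] H)) (K : Submodule ℂ H) (hK : ∀ a, ∀ v ∈ K, π a v ∈ K) :
    A →⋆ₙₐ[ℂ] (K →L[ℂ] K) where
  toFun a := K.orthogonalProjectionOnto ∘L π a ∘L K.subtypeL
  map_smul' c a := by ext; simp
  map_zero' := by ext; simp
  map_add' a b := by ext; simp
  map_mul' a b := by
    ext v
    have h : (K.orthogonalProjectionOnto (π b v) : H) = π b v :=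
      Submodule.starProjection_eq_self_iff.2 (hK b v v.2)
    simp [h]
  map_star' a := by
    rw [ContinuousLinearMap.star_eq_adjoint, ContinuousLinearMap.adjoint_comp,
      ContinuousLinearMap.adjoint_comp, map_star, ContinuousLinearMap.star_eq_adjoint,
      Submodule.adjoint_subtypeL, Submodule.adjoint_orthogonalProjectionOnto]
    rfl

theorem restrictRep_apply (hK : ∀ a, ∀ v ∈ K, π a v ∈ K) (a : A) (v : K) :
    (restrictRep π K hK a v : H) = π a v :=
  Submodule.starProjection_eq_self_iff.2 (hK a v v.2)

/-- The invariant subspaces on which a representation does not vanish. -/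
def essentialSubspaces (π : A →⋆ₙₐ[ℂ] (H →L[ℂ] H)) : Set (Submodule ℂ H) :=
  {K | (∀ a, ∀ v ∈ K, π a v ∈ K) ∧ ∃ a, ∃ v ∈ K, π a v ≠ 0}

/-- An invariant subspace of `K` on which `π` vanishes is orthogonal to `K`, since `π` does not
vanish on its orthogonal complement in `K`. -/
theorem eq_bot_or_eq_of_minimal (hK : Minimal (· ∈ essentialSubspaces π) K) {L : Submodule ℂ H}
    (hLK : L ≤ K) (hL : ∀ a, ∀ v ∈ L, π a v ∈ L) : L = ⊥ ∨ L = K := by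
  have : CompleteSpace H := FiniteDimensional.complete ℂ H
  by_cases hvanish : ∃ a, ∃ v ∈ L, π a v ≠ 0
  · exact .inr (hK.eq_of_le ⟨hL, hvanish⟩ hLK)
  push Not at hvanish
  obtain ⟨hKinv, a, v, hv, hav⟩ := hK.prop
  have hinv : ∀ b, ∀ w ∈ Lᗮ ⊓ K, π b w ∈ Lᗮ ⊓ K := fun b w hw =>
    ⟨apply_mem_orthogonal (fun x hx => by rw [← map_star]; exact hL _ x hx) w hw.1, hKinv b w hw.2⟩
  have hmem : v - L.starProjection v ∈ Lᗮ ⊓ K :=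
    ⟨L.sub_starProjection_mem_orthogonal v,
      K.sub_mem hv (hLK (L.starProjection_apply_mem v))⟩
  have hne : π a (v - L.starProjection v) ≠ 0 := by
    rwa [map_sub, hvanish a _ (L.starProjection_apply_mem v), sub_zero]
  have hperp : Lᗮ ⊓ K = K := hK.eq_of_le ⟨hinv, a, _, hmem, hne⟩ inf_le_right
  refine .inl (Submodule.eq_bot_iff _ |>.2 fun x hx => ?_)
  exact inner_self_eq_zero.1 ((hperp.ge (hLK hx)).1 x hx)

/-- A minimal essential subspace carries an irreducible representation, so it has dimension `n`. -/
theorem eq_bot_or_eq_top_of_isHomogeneous {n : ℕ} (hA : IsHomogeneous A n)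
    (hH : Module.finrank ℂ H = n) (h0 : π ≠ 0) {L : Submodule ℂ H}
    (hL : ∀ a, ∀ v ∈ L, π a v ∈ L) : L = ⊥ ∨ L = ⊤ := by
  obtain ⟨a, ha⟩ := DFunLike.ne_iff.1 h0
  obtain ⟨v, hv⟩ := DFunLike.ne_iff.1 ha
  obtain ⟨K, hK⟩ := exists_minimal_of_wellFoundedLT (· ∈ essentialSubspaces π)
    ⟨⊤, fun _ _ _ => Submodule.mem_top, a, v, Submodule.mem_top, hv⟩
  obtain ⟨hKinv, b, w, hw, hbw⟩ := hK.prop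
  have hne : ∃ a, restrictRep π K hKinv a ≠ 0 := ⟨b, fun h => hbw <| by
    rw [← restrictRep_apply hKinv b ⟨w, hw⟩, h]; rfl⟩
  have hirr (L : Submodule ℂ K) (hL : ∀ a, ∀ v ∈ L, restrictRep π K hKinv a v ∈ L) :
      L = ⊥ ∨ L = ⊤ := by
    have hinj := Submodule.map_injective_of_injective K.subtype_injective
    refine (eq_bot_or_eq_of_minimal hK (Submodule.map_subtype_le K L) ?_).imp
      (fun h => hinj (by rw [h, Submodule.map_bot]))
      fun h => hinj (by rw [h, Submodule.map_subtype_top])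
    rintro a _ ⟨v, hv, rfl⟩
    exact ⟨_, hL a v hv, restrictRep_apply hKinv a v⟩
  obtain ⟨H', _, _, _, π', hπ', hfin, -⟩ := exists_isIrreducibleRep_of_finiteDimensional hne hirr
  obtain rfl : K = ⊤ := Submodule.eq_top_of_finrank_eq (by rw [← hfin, hA H' π' hπ', hH])
  exact eq_bot_or_eq_of_minimal hK le_top hL

end Restriction

variable {n : ℕ}

theorem eq_bot_or_eq_top_of_isHomogeneous_matrix (hA : IsHomogeneous A n) {φ : A →⋆ₙₐ[ℂ] M n}
    (h0 : φ ≠ 0) {L : Submodule ℂ (EuclideanSpace ℂ (Fin n))}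
    (hL : ∀ a, ∀ v ∈ L, Matrix.toEuclideanCLM (𝕜 := ℂ) (φ a) v ∈ L) : L = ⊥ ∨ L = ⊤ :=
  eq_bot_or_eq_top_of_isHomogeneous hA finrank_euclideanSpace_fin
    (comp_ne_zero (Matrix.toEuclideanCLM (𝕜 := ℂ) (n := Fin n)) h0) hL

theorem surjective_of_isHomogeneous (hA : IsHomogeneous A n) {φ : A →⋆ₙₐ[ℂ] M n} (h0 : φ ≠ 0) :
    Function.Surjective φ := by
  refine surjective_of_irreducible_of_ne_zero (φ := (φ : A →ₙₐ[ℂ] M n))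
    (fun h => h0 (DFunLike.ext _ _ fun a => congr($h a))) fun K hK => ?_
  let e := WithLp.linearEquiv 2 ℂ (Fin n → ℂ)
  exact (eq_bot_or_eq_top_of_isHomogeneous_matrix hA h0
    (L := K.comap e.toLinearMap) fun a v hv => hK a _ hv).imp
    (fun h => Submodule.comap_injective_of_surjective e.surjective (by simpa using h))
    fun h => Submodule.comap_injective_of_surjective e.surjective (by simpa using h)

theorem isPrimitiveIdeal_ker (hA : IsHomogeneous A n) {φ : A →⋆ₙₐ[ℂ] M n} (h0 : φ ≠ 0) :
    IsPrimitiveIdeal (TwoSidedIdeal.ker φ) := by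
  obtain ⟨H, i₁, i₂, i₃, π, hπ, -, hker⟩ := exists_isIrreducibleRep_of_finiteDimensional
    (DFunLike.ne_iff.1 <| comp_ne_zero (Matrix.toEuclideanCLM (𝕜 := ℂ) (n := Fin n)) h0)
    fun L => eq_bot_or_eq_top_of_isHomogeneous_matrix hA h0
  exact ⟨H, i₁, i₂, i₃, π, hπ, by rw [hker, ker_comp]⟩

theorem exists_hom_of_isPrimitiveIdeal (hn : 1 ≤ n) (hA : IsHomogeneous A n)
    {I : TwoSidedIdeal A} (hI : IsPrimitiveIdeal I) :
    ∃ φ : A →⋆ₙₐ[ℂ] M n, φ ≠ 0 ∧ TwoSidedIdeal.ker φ = I := by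
  obtain ⟨H, _, _, _, π, hπ, rfl⟩ := hI
  have hH := hA H π hπ
  have : FiniteDimensional ℂ H := FiniteDimensional.of_finrank_pos (by rwa [hH])
  let b : OrthonormalBasis (Fin n) ℂ H := (stdOrthonormalBasis ℂ H).reindex (finCongr hH)
  let e : (H →L[ℂ] H) ≃⋆ₐ[ℂ] M n := b.repr.conjStarAlgEquiv.trans Matrix.toEuclideanCLM.symm
  exact ⟨e.toNonUnitalStarAlgHom.comp π, comp_ne_zero e hπ.ne_zero, ker_comp e π⟩

end Homogeneous

end FiniteDimensional

/-! ### Representations on `ℂⁿ` -/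

section MatrixReps

open scoped Matrix.Norms.L2Operator

section Excess

variable {D D' : Type*} [NonUnitalCStarAlgebra D] [NonUnitalCStarAlgebra D']

theorem map_cfcₙ_real (φ : D →⋆ₙₐ[ℂ] D') {f : ℝ → ℝ} (hf : Continuous f) (h0 : f 0 = 0) {d : D}
    (hd : IsSelfAdjoint d) : φ (cfcₙ f d) = cfcₙ f (φ d) :=
  NonUnitalStarAlgHom.map_cfcₙ φ f d hf.continuousOn h0
    (AddMonoidHomClass.continuous_of_bound φ 1 fun x => by
      simpa using NonUnitalStarAlgHom.norm_apply_le φ x) hd (hd.map φ)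

/-- The positive part `(a* a - c²)₊`. It is an element of `D` whose image in a representation
vanishes exactly where the norm of `a` is at most `c`. -/
def excess (a : D) (c : ℝ) : D := cfcₙ (fun r : ℝ => max (|r| - c ^ 2) 0) (star a * a)

theorem map_excess (φ : D →⋆ₙₐ[ℂ] D') (a : D) (c : ℝ) : φ (excess a c) = excess (φ a) c := by
  rw [excess, map_cfcₙ_real φ (by fun_prop) (by simp [sq_nonneg]) (.star_mul_self a), map_mul,
    map_star, excess]

theorem excess_eq_zero_iff (a : D) {c : ℝ} (hc : 0 ≤ c) : excess a c = 0 ↔ ‖a‖ ≤ c := by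
  have ha : IsSelfAdjoint (star a * a) := .star_mul_self a
  have h0 : max (|(0 : ℝ)| - c ^ 2) 0 = 0 := by simp [sq_nonneg]
  calc excess a c = 0
      ↔ ∀ r ∈ quasispectrum ℝ (star a * a), max (|r| - c ^ 2) 0 = 0 := by
        rw [excess, ← cfcₙ_const_zero ℝ (star a * a)]
        exact cfcₙ_eq_cfcₙ_iff_eqOn ha (by fun_prop) h0
    _ ↔ ∀ r ∈ quasispectrum ℝ (star a * a), ‖id r‖ ≤ c ^ 2 := by simp
    _ ↔ ‖star a * a‖ ≤ c ^ 2 := by rw [← norm_cfcₙ_le_iff id (star a * a), cfcₙ_id ℝ _]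
    _ ↔ ‖a‖ ≤ c := by
      rw [CStarRing.norm_star_mul_self, ← sq, sq_le_sq₀ (norm_nonneg a) hc]

end Excess

theorem exists_starAlgEquiv_of_ker_eq {C D D' : Type*} [NonUnitalRing C] [Module ℂ C] [StarRing C]
    [NonUnitalRing D] [Module ℂ D] [StarRing D] [NonUnitalRing D'] [Module ℂ D'] [StarRing D']
    {φ : C →⋆ₙₐ[ℂ] D} {ψ : C →⋆ₙₐ[ℂ] D'} (hφ : Function.Surjective φ)
    (hψ : Function.Surjective ψ) (hker : TwoSidedIdeal.ker φ = TwoSidedIdeal.ker ψ) :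
    ∃ g : D ≃⋆ₐ[ℂ] D', ∀ a, g (φ a) = ψ a := by
  have key (a b : C) : φ a = φ b ↔ ψ a = ψ b := by
    simp only [← sub_eq_zero (a := φ a), ← sub_eq_zero (a := ψ a), ← map_sub,
      ← TwoSidedIdeal.mem_ker, hker]
  let s := Function.surjInv hφ
  have hs (m : D) : φ (s m) = m := Function.surjInv_eq hφ m
  have hψs {m : D} {a : C} (h : φ a = m) : ψ (s m) = ψ a := (key _ _).1 ((hs m).trans h.symm)
  let g : D →⋆ₙₐ[ℂ] D' :=
    { toFun := fun m => ψ (s m)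
      map_smul' := fun c m => by rw [hψs (a := c • s m) (by rw [map_smul, hs]), map_smul]; rfl
      map_zero' := by rw [hψs (map_zero φ), map_zero]
      map_add' := fun x y => by rw [hψs (a := s x + s y) (by rw [map_add, hs, hs]), map_add]
      map_mul' := fun x y => by rw [hψs (a := s x * s y) (by rw [map_mul, hs, hs]), map_mul]
      map_star' := fun x => by rw [hψs (a := star (s x)) (by rw [map_star, hs]), map_star] }
  have hg (a : C) : g (φ a) = ψ a := hψs rfl
  refine ⟨StarAlgEquiv.ofBijective g ⟨fun x y hxy => ?_, fun y => ?_⟩, hg⟩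
  · rw [← hs x, ← hs y]
    exact (key _ _).2 hxy
  · obtain ⟨a, rfl⟩ := hψ y
    exact ⟨φ a, hg a⟩

variable {A : Type u} [NonUnitalCStarAlgebra A] {n : ℕ}

variable (A n) in
theorem isCompact_range_coe_hom :
    IsCompact (Set.range ((⇑) : (A →⋆ₙₐ[ℂ] M n) → A → M n)) := by
  have hball : IsCompact (Set.univ.pi fun a : A => Metric.closedBall (0 : M n) ‖a‖) :=
    isCompact_univ_pi fun a => isCompact_closedBall 0 ‖a‖
  have hrange : Set.range ((⇑) : (A →⋆ₙₐ[ℂ] M n) → A → M n) =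
      {f | ∀ (c : ℂ) x, f (c • x) = c • f x} ∩ ({f | ∀ x y, f (x + y) = f x + f y} ∩
        ({f | ∀ x y, f (x * y) = f x * f y} ∩ {f | ∀ x, f (star x) = star (f x)})) := by
    refine subset_antisymm ?_ ?_
    · rintro _ ⟨φ, rfl⟩
      exact ⟨map_smul φ, map_add φ, map_mul φ, map_star φ⟩
    · rintro f ⟨hsmul, hadd, hmul, hstar⟩
      exact ⟨{ toFun := f, map_smul' := hsmul, map_add' := hadd, map_mul' := hmul,
               map_star' := hstar, map_zero' := by simpa using hsmul 0 0 }, rfl⟩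
  refine hball.of_isClosed_subset ?_ ?_
  · rw [hrange]
    refine (isClosed_setOfPred_map_smul A (M n) id).inter (
      (isClosed_setOfPred_map_add A (M n)).inter
      ((isClosed_setOfPred_map_mul A (M n)).inter ?_))
    simp only [Set.ofPred_forall]
    exact isClosed_iInter fun x => isClosed_eq (by fun_prop) (by fun_prop)
  · rintro _ ⟨φ, rfl⟩ a -
    simpa using NonUnitalStarAlgHom.norm_apply_le φ a

variable {T : Type v} [TopologicalSpace T]

/-- A point `t` of the spectrum together with a representation `A → Mₙ` with kernel `θ t`. These
are the points of the total space of the principal `Aut(Mₙ)`-bundle of `A`. -/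
@[ext]
structure MatrixRep (θ : T ≃ₜ PrimitiveSpectrum A) (n : ℕ) where
  base : T
  hom : A →⋆ₙₐ[ℂ] M n
  ker_hom : TwoSidedIdeal.ker hom = (θ base).1

variable {θ : T ≃ₜ PrimitiveSpectrum A}

instance : TopologicalSpace (MatrixRep θ n) :=
  TopologicalSpace.induced (fun x (a : A) => x.hom a) inferInstance

theorem exists_eq_of_isPrimitiveIdeal (θ : T ≃ₜ PrimitiveSpectrum A) {I : TwoSidedIdeal A}
    (hI : IsPrimitiveIdeal I) : ∃ t, (θ t).1 = I := by
  obtain ⟨t, ht⟩ := θ.surjective (⟨I, hI⟩ : {I : TwoSidedIdeal A // IsPrimitiveIdeal I})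
  exact ⟨t, congrArg Subtype.val ht⟩

theorem isOpen_notMem (θ : T ≃ₜ PrimitiveSpectrum A) (a : A) : IsOpen {t | a ∉ (θ t).1} :=
  (TopologicalSpace.isOpen_generateFrom_of_mem ⟨a, rfl⟩ :
    IsOpen {P : PrimitiveSpectrum A | a ∉ P.1}).preimage θ.continuous

namespace MatrixRep

theorem hom_eq_zero_iff (x : MatrixRep θ n) (a : A) : x.hom a = 0 ↔ a ∈ (θ x.base).1 := by
  rw [← x.ker_hom, TwoSidedIdeal.mem_ker]

theorem hom_ne_zero (x : MatrixRep θ n) : x.hom ≠ 0 := by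
  intro h
  obtain ⟨H, _, _, _, π, hπ, hI⟩ := (θ x.base).2
  refine hπ.ne_zero (NonUnitalStarAlgHom.ext fun a => ?_)
  have : a ∈ TwoSidedIdeal.ker π := hI ▸ (x.hom_eq_zero_iff a).1 (by rw [h]; rfl)
  exact (TwoSidedIdeal.mem_ker π).1 this

theorem continuous_hom_apply (a : A) : Continuous fun x : MatrixRep θ n => x.hom a :=
  (continuous_apply a).comp continuous_induced_dom

theorem continuous_base : Continuous (base : MatrixRep θ n → T) := by
  have : Continuous fun x : MatrixRep θ n => θ x.base := by
    rw [continuous_generateFrom_iff]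
    rintro _ ⟨a, rfl⟩
    have : (fun x : MatrixRep θ n => θ x.base) ⁻¹' {P : PrimitiveSpectrum A | a ∉ P.1} =
        {x | x.hom a ≠ 0} := Set.ext fun x => not_congr (x.hom_eq_zero_iff a).symm
    rw [this]
    exact isOpen_ne_fun (continuous_hom_apply a) continuous_const
  simpa [Function.comp_def] using θ.symm.continuous.comp this

theorem exists_isOpen_lt_norm (x : MatrixRep θ n) (a : A) {c : ℝ} (hc : 0 ≤ c)
    (hx : c < ‖x.hom a‖) :
    ∃ U, IsOpen U ∧ x.base ∈ U ∧ ∀ y : MatrixRep θ n, y.base ∈ U → c < ‖y.hom a‖ := by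
  have key (y : MatrixRep θ n) : excess a c ∉ (θ y.base).1 ↔ c < ‖y.hom a‖ := by
    rw [← hom_eq_zero_iff, map_excess, excess_eq_zero_iff _ hc, not_le]
  exact ⟨_, isOpen_notMem θ (excess a c), (key x).2 hx, fun y => (key y).1⟩

section Homogeneous

variable (hn : 1 ≤ n) (hA : IsHomogeneous A n)

include hA

theorem surjective (x : MatrixRep θ n) : Function.Surjective x.hom :=
  surjective_of_isHomogeneous hA x.hom_ne_zero

theorem exists_hom_eq {φ : A →⋆ₙₐ[ℂ] M n} (h0 : φ ≠ 0) : ∃ x : MatrixRep θ n, x.hom = φ := by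
  obtain ⟨t, ht⟩ := exists_eq_of_isPrimitiveIdeal θ (isPrimitiveIdeal_ker hA h0)
  exact ⟨⟨t, φ, ht.symm⟩, rfl⟩

theorem exists_equiv {x y : MatrixRep θ n} (h : x.base = y.base) :
    ∃ g : M n ≃⋆ₐ[ℂ] M n, ∀ a, g (x.hom a) = y.hom a :=
  exists_starAlgEquiv_of_ker_eq (x.surjective hA) (y.surjective hA) <| by
    rw [x.ker_hom, y.ker_hom, h]

theorem norm_eq {x y : MatrixRep θ n} (h : x.base = y.base) (a : A) :
    ‖x.hom a‖ = ‖y.hom a‖ := by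
  obtain ⟨g, hg⟩ := exists_equiv hA h
  rw [← hg, StarAlgEquiv.norm_map]

theorem isCompact_coe_hom_preimage {S : Set (A → M n)} (hS : IsClosed S) (h0 : 0 ∉ S) :
    IsCompact {x : MatrixRep θ n | ⇑x.hom ∈ S} := by
  have hind : IsInducing fun x : MatrixRep θ n => ⇑x.hom := ⟨rfl⟩
  have himage : (fun x : MatrixRep θ n => ⇑x.hom) '' {x | ⇑x.hom ∈ S} =
      Set.range ((⇑) : (A →⋆ₙₐ[ℂ] M n) → A → M n) ∩ S := by
    refine subset_antisymm ?_ ?_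
    · rintro _ ⟨x, hx, rfl⟩
      exact ⟨⟨x.hom, rfl⟩, hx⟩
    · rintro _ ⟨⟨φ, rfl⟩, hφ⟩
      obtain ⟨x, rfl⟩ := exists_hom_eq (θ := θ) hA (φ := φ) fun h => h0 (by simpa [h] using hφ)
      exact ⟨x, hφ, rfl⟩
  rw [hind.isCompact_iff, himage]
  exact (isCompact_range_coe_hom A n).inter_right hS

theorem isCompact_le_norm (a : A) {ε : ℝ} (hε : 0 < ε) :
    IsCompact {x : MatrixRep θ n | ε ≤ ‖x.hom a‖} :=
  isCompact_coe_hom_preimage hA (S := {f | ε ≤ ‖f a‖})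
    (isClosed_le continuous_const (continuous_apply a).norm) (by simpa using hε)

include hn

theorem exists_base_eq (t : T) : ∃ x : MatrixRep θ n, x.base = t := by
  obtain ⟨φ, -, hφ⟩ := exists_hom_of_isPrimitiveIdeal hn hA (θ t).2
  exact ⟨⟨t, φ, hφ⟩, rfl⟩

theorem isQuotientMap_base [T2Space T] : IsQuotientMap (base : MatrixRep θ n → T) := by
  rw [isQuotientMap_iff_isClosed]
  refine ⟨exists_base_eq hn hA, fun S => ⟨fun h => h.preimage continuous_base, fun h => ?_⟩⟩
  refine isClosed_of_closure_subset fun t ht => ?_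
  obtain ⟨x, rfl⟩ := exists_base_eq (θ := θ) hn hA t
  have : Nonempty (Fin n) := ⟨⟨0, hn⟩⟩
  obtain ⟨a, ha⟩ := x.surjective hA 1
  obtain ⟨U, hU, hxU, hUn⟩ :=
    exists_isOpen_lt_norm x a (c := 1 / 2) (by norm_num) (by rw [ha, norm_one]; norm_num)
  have hclosed : IsClosed (base '' ({x : MatrixRep θ n | 1 / 2 ≤ ‖x.hom a‖} ∩ base ⁻¹' S)) :=
    (((isCompact_le_norm hA a (by norm_num)).inter_right h).image continuous_base).isClosed
  have hsub : U ∩ S ⊆ base '' ({x : MatrixRep θ n | 1 / 2 ≤ ‖x.hom a‖} ∩ base ⁻¹' S) := by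
    rintro s ⟨hsU, hsS⟩
    obtain ⟨y, rfl⟩ := exists_base_eq (θ := θ) hn hA s
    exact ⟨y, ⟨(hUn y hsU).le, hsS⟩, rfl⟩
  obtain ⟨y, ⟨-, hyS⟩, hy⟩ := hclosed.closure_subset_iff.2 hsub (hU.inter_closure ⟨hxU, ht⟩)
  exact hy ▸ hyS

theorem eq_zero_of_forall_hom {a : A} (h : ∀ x : MatrixRep θ n, x.hom a = 0) : a = 0 := by
  by_contra ha
  obtain ⟨H, i₁, i₂, i₃, π, hπ, hne⟩ := exists_isIrreducibleRep_apply_ne_zero ha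
  obtain ⟨t, ht⟩ := exists_eq_of_isPrimitiveIdeal θ ⟨H, i₁, i₂, i₃, π, hπ, rfl⟩
  obtain ⟨x, rfl⟩ := exists_base_eq (θ := θ) hn hA t
  exact hne ((TwoSidedIdeal.mem_ker π).1 (ht ▸ (x.hom_eq_zero_iff a).1 (h x)))

theorem eq_of_forall_hom {a b : A} (h : ∀ x : MatrixRep θ n, x.hom a = x.hom b) : a = b :=
  sub_eq_zero.1 (eq_zero_of_forall_hom (θ := θ) hn hA fun x => by rw [map_sub, h, sub_self])

theorem norm_le_of_forall_hom {a : A} {c : ℝ} (hc : 0 ≤ c)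
    (h : ∀ x : MatrixRep θ n, ‖x.hom a‖ ≤ c) : ‖a‖ ≤ c := by
  rw [← excess_eq_zero_iff a hc]
  refine eq_zero_of_forall_hom (θ := θ) hn hA fun x => ?_
  rw [map_excess, excess_eq_zero_iff _ hc]
  exact h x

theorem isOpen_forall_base_eq [T2Space T] {Q : MatrixRep θ n → Prop} (hQ : IsOpen {x | Q x})
    (hinv : ∀ x y, x.base = y.base → Q x → Q y) : IsOpen {t | ∀ x, x.base = t → Q x} := by
  rw [← (isQuotientMap_base hn hA).isOpen_preimage]
  convert hQ using 1
  exact Set.ext fun x => ⟨fun h => h x rfl, fun h y hy => hinv x y hy.symm h⟩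

theorem isOpen_norm_lt [T2Space T] (a : A) (c : ℝ) :
    IsOpen {t | ∀ x : MatrixRep θ n, x.base = t → ‖x.hom a‖ < c} :=
  isOpen_forall_base_eq hn hA (isOpen_lt (continuous_hom_apply a).norm continuous_const)
    fun _ _ h hx => norm_eq hA h a ▸ hx

end Homogeneous

end MatrixRep

end MatrixReps

/-! ### Lifting matrix units -/

section Bump

open scoped Matrix.Norms.L2Operator

theorem cfcₙ_hom_pi {k : ℕ} {D : Type*} [NonUnitalCStarAlgebra D] (ψ : (Fin k → ℂ) →⋆ₙₐ[ℂ] D)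
    {f : ℝ → ℝ} (hf : Continuous f) (h0 : f 0 = 0) (d : Fin k → ℝ) :
    cfcₙ f (ψ fun i => (d i : ℂ)) = ψ fun i => (f (d i) : ℂ) := by
  have hi (i : Fin k) : IsSelfAdjoint (d i : ℂ) := Complex.conj_ofReal (d i)
  have hsa : IsSelfAdjoint (fun i => (d i : ℂ)) := funext hi
  rw [← map_cfcₙ_real ψ hf h0 hsa, cfcₙ_map_pi (S := ℂ) f _ hf.continuousOn hsa hi]
  congr 1
  funext i
  rw [cfcₙ_eq_cfc hf.continuousOn h0]
  exact cfc_algebraMap (d i) f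

/-- The embedding of `ℂⁿ` as the diagonal matrices. -/
def diagonalHom (n : ℕ) : (Fin n → ℂ) →⋆ₙₐ[ℂ] M n where
  toFun := Matrix.diagonal
  map_smul' c x := Matrix.diagonal_smul c x
  map_zero' := Matrix.diagonal_zero
  map_add' x y := (Matrix.diagonal_add x y).symm
  map_mul' x y := (Matrix.diagonal_mul_diagonal' x y).symm
  map_star' x := (Matrix.diagonal_conjTranspose x).symm

/-- A bump function at `j + 1` with support of radius `w / 4`; its value at `j + 1` is `1` if
`1 ≤ w`. It serves to cut approximate spectral projections out of an element whose spectrum at one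
point of `T` consists of the numbers `1, …, k`. -/
def bump (w : ℝ) (j : ℕ) (r : ℝ) : ℝ := max 0 (min 1 (w - 4 * |r - (j + 1)|))

variable {w w' : ℝ} {i j : ℕ}

theorem continuous_bump (w : ℝ) (j : ℕ) : Continuous (bump w j) := by unfold bump; fun_prop

theorem bump_eq_zero {r : ℝ} (h : w ≤ 4 * |r - (j + 1)|) : bump w j r = 0 :=
  max_eq_left ((min_le_right _ _).trans (by linarith))

theorem bump_eq_one {r : ℝ} (h : 1 + 4 * |r - (j + 1)| ≤ w) : bump w j r = 1 := by
  rw [bump, min_eq_left (by linarith), max_eq_right zero_le_one]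

theorem one_le_abs_natCast_sub (h : i ≠ j) : (1 : ℝ) ≤ |(i : ℝ) - j| := by
  have : (1 : ℤ) ≤ |(i : ℤ) - j| := Int.one_le_abs (by lia)
  exact_mod_cast this

theorem bump_zero (hw : w ≤ 4) : bump w j 0 = 0 := by
  refine bump_eq_zero ?_
  rw [zero_sub, abs_neg, abs_of_nonneg (by positivity)]
  linarith [Nat.cast_nonneg (α := ℝ) j]

theorem bump_natCast_add_one (h1 : 1 ≤ w) (h4 : w ≤ 4) (j k : ℕ) :
    bump w j (k + 1 : ℝ) = if k = j then 1 else 0 := by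
  split_ifs with h
  · subst h
    exact bump_eq_one (by simpa using h1)
  · refine bump_eq_zero ?_
    rw [add_sub_add_right_eq_sub]
    linarith [one_le_abs_natCast_sub h]

theorem bump_mul_bump_of_ne (h : i ≠ j) (hw : w + w' ≤ 4) (r : ℝ) :
    bump w i r * bump w' j r = 0 := by
  by_cases h1 : w ≤ 4 * |r - (i + 1)|
  · rw [bump_eq_zero h1, zero_mul]
  · have h2 : |(i : ℝ) - j| ≤ |r - (j + 1)| + |r - (i + 1)| := by
      rw [show (i : ℝ) - j = (r - (j + 1)) - (r - (i + 1)) by ring]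
      exact abs_sub _ _
    rw [bump_eq_zero (w := w') (by linarith [one_le_abs_natCast_sub h]), mul_zero]

theorem bump_mul_bump_add_one (w : ℝ) (j : ℕ) (r : ℝ) :
    bump w j r * bump (w + 1) j r = bump w j r := by
  by_cases h1 : w ≤ 4 * |r - (j + 1)|
  · rw [bump_eq_zero h1, zero_mul]
  · rw [bump_eq_one (w := w + 1) (by linarith), mul_one]

variable {D : Type*} [NonUnitalCStarAlgebra D]

theorem cfcₙ_bump_mul_of_ne (d : D) (h : i ≠ j) (hw : w ≤ 4) (hw' : w' ≤ 4) (hww' : w + w' ≤ 4) :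
    cfcₙ (bump w i) d * cfcₙ (bump w' j) d = 0 := by
  rw [← cfcₙ_mul _ _ d (continuous_bump w i).continuousOn (bump_zero hw)
    (continuous_bump w' j).continuousOn (bump_zero hw')]
  simp only [bump_mul_bump_of_ne h hww']
  exact cfcₙ_const_zero ℝ d

theorem cfcₙ_bump_mul_add_one (d : D) (hw : w ≤ 3) :
    cfcₙ (bump w j) d * cfcₙ (bump (w + 1) j) d = cfcₙ (bump w j) d := by
  rw [← cfcₙ_mul _ _ d (continuous_bump w j).continuousOn (bump_zero (by linarith))
    (continuous_bump (w + 1) j).continuousOn (bump_zero (by linarith))]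
  simp only [bump_mul_bump_add_one]

theorem cfcₙ_bump_hom_pi {k : ℕ} (ψ : (Fin k → ℂ) →⋆ₙₐ[ℂ] D) (h1 : 1 ≤ w) (h4 : w ≤ 4)
    (j : Fin k) : cfcₙ (bump w j) (ψ fun i => ((i + 1 : ℝ) : ℂ)) = ψ (Pi.single j 1) := by
  rw [cfcₙ_hom_pi ψ (continuous_bump w j) (bump_zero h4)]
  congr 1
  ext i
  rw [bump_natCast_add_one h1 h4]
  by_cases h : i = j <;> simp [h, Fin.val_inj]

end Bump

section MatrixUnits

open scoped Matrix.Norms.L2Operator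

open Matrix

variable {n : ℕ}

theorem exists_unitary_columns {u : Fin n → Fin n → ℂ} (h0 : ∀ i, u i ≠ 0)
    (horth : Pairwise fun i j => star (u i) ⬝ᵥ u j = 0) :
    ∃ (U : unitary (M n)) (c : Fin n → ℂ), ∀ k i, (U : M n) k i = c i * u i k := by
  let c (i : Fin n) : ℂ := (‖WithLp.toLp 2 (u i)‖ : ℂ)⁻¹
  let U : M n := of fun k i => c i * u i k
  have hU : star U * U = 1 := by
    ext i j
    have hentry : (star U * U) i j = star (c i) * c j * (star (u i) ⬝ᵥ u j) := by
      simp only [U, mul_apply, star_apply, of_apply, dotProduct, Finset.mul_sum, star_mul,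
        Pi.star_apply]
      exact Finset.sum_congr rfl fun k _ => by ring
    rw [hentry]
    rcases eq_or_ne i j with rfl | hij
    · have hne : (‖WithLp.toLp 2 (u i)‖ : ℂ) ≠ 0 := by simpa using h0 i
      have hsq : star (u i) ⬝ᵥ u i = (‖WithLp.toLp 2 (u i)‖ : ℂ) ^ 2 := by
        rw [← Complex.ofReal_pow, EuclideanSpace.norm_sq_eq]
        simp [dotProduct, Complex.conj_mul']
      simp [c, hsq, one_apply_eq, field]
    · rw [horth hij, mul_zero, one_apply_ne hij]
  exact ⟨⟨U, hU, mul_eq_one_comm.1 hU⟩, c, fun k i => rfl⟩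

/-- Nonzero columns of the `P i` give an orthogonal basis in which all `P i` are diagonal. -/
theorem exists_starAlgEquiv_eq_single {P : Fin n → M n} (hsa : ∀ i, IsSelfAdjoint (P i))
    (h0 : ∀ i, P i ≠ 0) (horth : Pairwise fun i j => P i * P j = 0) :
    ∃ g : M n ≃⋆ₐ[ℂ] M n, ∀ i, ∃ c ≠ 0, g (P i) = single i i c := by
  have hcol (i : Fin n) : ∃ q, (P i).col q ≠ 0 := by
    by_contra! h
    exact h0 i (ext_col h)
  choose q hq using hcol
  obtain ⟨U, c, hU⟩ := exists_unitary_columns hq fun i j hij => by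
    have hrow : star ((P i).col (q i)) = (P i).row (q i) := by
      conv_rhs => rw [← (hsa i).star_eq]
      rfl
    have hmul : (P i).row (q i) ⬝ᵥ (P j).col (q j) = 0 := congrFun₂ (horth hij) (q i) (q j)
    simpa only [hrow] using hmul
  let g := Unitary.conjStarAlgAut ℂ (M n) (star U)
  refine ⟨g, fun i => ⟨g (P i) i i, ?_⟩⟩
  have hPU (l : Fin n) (hl : l ≠ i) (r : Fin n) : (P i * U) r l = 0 := by
    have : (P i * P l) r (q l) = 0 := congrFun₂ (horth hl.symm) r (q l)
    simp only [mul_apply, hU] at this ⊢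
    simp only [col_apply, mul_left_comm _ (c l), ← Finset.mul_sum, this, mul_zero]
  have hright (k l : Fin n) (hl : l ≠ i) : g (P i) k l = 0 := by
    simp only [g, Unitary.conjStarAlgAut_star_apply, mul_assoc]
    rw [mul_apply]
    simp [hPU l hl]
  have hsymm (k l : Fin n) : g (P i) k l = star (g (P i) l k) :=
    congrFun₂ ((hsa i).map g).star_eq.symm k l
  have hsingle : g (P i) = single i i (g (P i) i i) := by
    ext k l
    by_cases hl : l = i
    · by_cases hk : k = i
      · simp [hk, hl]
      · rw [hsymm, hright l k hk, star_zero, single_apply_of_row_ne (Ne.symm hk)]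
    · rw [hright k l hl, single_apply_of_col_ne _ _ (Ne.symm hl)]
  refine ⟨fun h => h0 i ?_, hsingle⟩
  rw [h, single_zero] at hsingle
  exact (map_eq_zero_iff g g.injective).1 hsingle

theorem exists_starAlgEquiv_single_mul {u : Fin n → ℂ} (hu : ∀ i, ‖u i‖ = 1) :
    ∃ g : M n ≃⋆ₐ[ℂ] M n, ∀ i j c, g (single i j c) = single i j (u i * c * star (u j)) := by
  have hone (i : Fin n) : star (u i) * u i = 1 := by
    simpa [hu i] using Complex.conj_mul' (u i)
  have hU : star (diagonal u) * diagonal u = 1 := by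
    rw [star_eq_conjTranspose, diagonal_conjTranspose, diagonal_mul_diagonal, ← diagonal_one]
    exact congrArg diagonal (funext hone)
  refine ⟨Unitary.conjStarAlgAut ℂ (M n) ⟨diagonal u, hU, mul_eq_one_comm.1 hU⟩, fun i j c => ?_⟩
  ext k l
  simp only [Unitary.conjStarAlgAut_apply, star_eq_conjTranspose,
    diagonal_conjTranspose, mul_diagonal, diagonal_mul, Pi.star_apply, single_apply]
  split_ifs with h <;> simp [h]

/-- A continuous function vanishing at `0` that agrees with `r ↦ 1 / √r` for `1 / 2 ≤ r`. -/
def cutRsqrt (r : ℝ) : ℝ := r * ((√(max r (1 / 2)))⁻¹) ^ 3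

theorem continuous_cutRsqrt : Continuous cutRsqrt := by
  have hpos (r : ℝ) : √(max r (1 / 2)) ≠ 0 :=
    (Real.sqrt_pos.2 (lt_max_of_lt_right one_half_pos)).ne'
  exact continuous_id.mul ((Continuous.inv₀ (by fun_prop) hpos).pow 3)

theorem cutRsqrt_zero : cutRsqrt 0 = 0 := zero_mul _

theorem mul_cutRsqrt_sq {r : ℝ} (h0 : 0 ≤ r) (h : 1 / 2 ≤ r ^ 2) : r * cutRsqrt (r ^ 2) = 1 := by
  have : r ≠ 0 := by rintro rfl; norm_num at h
  rw [cutRsqrt, max_eq_left h, Real.sqrt_sq h0]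
  field_simp

/-- An element whose image in a representation is the partial isometry in the polar decomposition
of the image of `v`, provided that the spectrum of `|v|²` lies in `{0} ∪ [1 / 2, ∞)` there. -/
def polarPart {D : Type*} [NonUnitalCStarAlgebra D] (v : D) : D := v * cfcₙ cutRsqrt (star v * v)

theorem map_polarPart {D D' : Type*} [NonUnitalCStarAlgebra D] [NonUnitalCStarAlgebra D']
    (φ : D →⋆ₙₐ[ℂ] D') (v : D) : φ (polarPart v) = polarPart (φ v) := by
  rw [polarPart, map_mul, map_cfcₙ_real φ continuous_cutRsqrt cutRsqrt_zero (.star_mul_self v),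
    map_mul, map_star, polarPart]

theorem cfcₙ_single {f : ℝ → ℝ} (hf : Continuous f) (h0 : f 0 = 0) (o : Fin n) (r : ℝ) :
    cfcₙ f (single o o (r : ℂ)) = single o o (f r : ℂ) := by
  have hdiag (s : ℝ) :
      single o o (s : ℂ) = diagonalHom n fun i => ((Pi.single o s : _ → ℝ) i : ℂ) := by
    rw [← diagonal_single]
    exact congrArg diagonal (funext fun i => by by_cases h : i = o <;> simp [h])
  rw [hdiag, cfcₙ_hom_pi _ hf h0, hdiag]
  congr 1
  funext i
  by_cases h : i = o <;> simp [h, h0]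

theorem star_single_mul_single (j o : Fin n) (s : ℂ) :
    star (single j o s) * single j o s = single o o ((‖s‖ ^ 2 : ℝ) : ℂ) := by
  rw [star_eq_conjTranspose, conjTranspose_single, single_mul_single_same]
  simp [Complex.conj_mul']

theorem norm_single (j o : Fin n) (s : ℂ) : ‖single j o s‖ = ‖s‖ := by
  rw [← sq_eq_sq₀ (norm_nonneg _) (norm_nonneg s), sq, ← CStarRing.norm_star_mul_self,
    star_single_mul_single, ← diagonal_single, l2_opNorm_diagonal, Pi.norm_single]
  simp

theorem exists_polarPart_single (j o : Fin n) {s : ℂ} (h : 1 / 2 ≤ ‖s‖ ^ 2) :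
    ∃ α : ℂ, ‖α‖ = 1 ∧ polarPart (single j o s) = single j o α := by
  refine ⟨s * cutRsqrt (‖s‖ ^ 2), ?_, ?_⟩
  · have := mul_cutRsqrt_sq (norm_nonneg s) h
    rw [norm_mul, Complex.norm_real, ← norm_norm s, ← norm_mul, norm_norm s, this, norm_one]
  · rw [polarPart, star_single_mul_single, cfcₙ_single continuous_cutRsqrt cutRsqrt_zero,
      single_mul_single_same]

end MatrixUnits

section LocalFrame

open scoped Matrix.Norms.L2Operator

open Matrix

variable {A : Type u} [NonUnitalCStarAlgebra A] {T : Type v} [TopologicalSpace T]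
  {θ : T ≃ₜ PrimitiveSpectrum A} {n : ℕ}

/-- The representation obtained by composition with an automorphism of `Mₙ`. -/
def MatrixRep.conj (g : M n ≃⋆ₐ[ℂ] M n) (x : MatrixRep θ n) : MatrixRep θ n where
  base := x.base
  hom := g.toNonUnitalStarAlgHom.comp x.hom
  ker_hom := (ker_comp g x.hom).trans x.ker_hom

/-- Partial isometries `w i` from the `o`-th to the `i`-th line become the first column of a system
of matrix units after rotating the phases. -/
theorem exists_starAlgEquiv_of_lines {P v : Fin n → M n} (o : Fin n)
    (hsa : ∀ i, IsSelfAdjoint (P i)) (horth : Pairwise fun i j => P i * P j = 0)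
    (hv : ∀ i, ∃ m, v i = P i * m * P o) (hnorm : ∀ i, 3 / 4 < ‖v i‖) :
    ∃ g : M n ≃⋆ₐ[ℂ] M n, (∀ i, ∃ c ≠ 0, g (P i) = single i i c) ∧
      ∀ i j, g (polarPart (v i) * star (polarPart (v j))) = single i j 1 := by
  have h0 (i : Fin n) : P i ≠ 0 := by
    rintro h
    obtain ⟨m, hm⟩ := hv i
    have := hnorm i
    rw [hm, h, zero_mul, zero_mul, norm_zero] at this
    norm_num at this
  obtain ⟨g₁, hg₁⟩ := exists_starAlgEquiv_eq_single hsa h0 horth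
  choose c hc hg₁ using hg₁
  have hsingle (i : Fin n) : ∃ s, g₁ (v i) = single i o s := by
    obtain ⟨m, hm⟩ := hv i
    exact ⟨c i * g₁ m i o * c o, by
      rw [hm, map_mul, map_mul, hg₁, hg₁, single_mul_mul_single]⟩
  choose s hs using hsingle
  have hpolar (i : Fin n) : ∃ α : ℂ, ‖α‖ = 1 ∧ g₁ (polarPart (v i)) = single i o α := by
    have hlt : 3 / 4 < ‖s i‖ := by
      rw [← norm_single i o, ← hs, StarAlgEquiv.norm_map]
      exact hnorm i
    obtain ⟨α, hα, h⟩ := exists_polarPart_single i o (s := s i) (by nlinarith)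
    exact ⟨α, hα, by rw [← h, ← hs]; exact map_polarPart g₁.toNonUnitalStarAlgHom (v i)⟩
  choose α hα hpolar using hpolar
  obtain ⟨g₂, hg₂⟩ :=
    exists_starAlgEquiv_single_mul (u := fun i => star (α i)) fun i => by simp [hα]
  have hone (i : Fin n) : star (α i) * α i = 1 := by simpa [hα i] using Complex.conj_mul' (α i)
  refine ⟨g₁.trans g₂, fun i => ⟨c i, hc i, ?_⟩, fun i j => ?_⟩
  · rw [StarAlgEquiv.trans_apply, hg₁, hg₂, mul_right_comm, star_star, hone, one_mul]
  · rw [StarAlgEquiv.trans_apply, map_mul, map_star, hpolar, hpolar, star_eq_conjTranspose,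
      conjTranspose_single, single_mul_single_same, hg₂, star_star, ← mul_assoc, hone, one_mul,
      hone]

theorem MatrixRep.exists_isOpen_matrixUnits (hn : 1 ≤ n) (hA : IsHomogeneous A n)
    (x : MatrixRep θ n) {p : Fin n → A} (hsa : ∀ i, IsSelfAdjoint (p i))
    (horth : Pairwise fun i j => p i * p j = 0) (hx : ∀ i, x.hom (p i) = single i i 1) :
    ∃ (e : Fin n → Fin n → A) (U : Set T), IsOpen U ∧ x.base ∈ U ∧ ∀ t ∈ U,
      ∃ y : MatrixRep θ n, y.base = t ∧ (∀ i j, y.hom (e i j) = single i j 1) ∧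
        ∀ i, ∃ c ≠ 0, y.hom (p i) = single i i c := by
  let o : Fin n := ⟨0, hn⟩
  choose X hX using fun j => x.surjective hA (single j o 1)
  let v (j : Fin n) : A := p j * X j * p o
  have hxv (j : Fin n) : x.hom (v j) = single j o 1 := by simp [v, hx, hX]
  have hopen (j : Fin n) := x.exists_isOpen_lt_norm (v j) (c := 3 / 4) (by norm_num) <| by
    rw [hxv, norm_single, norm_one]
    norm_num
  choose U hU hxU hUv using hopen
  refine ⟨fun i j => polarPart (v i) * star (polarPart (v j)), ⋂ j, U j,
    isOpen_iInter_of_finite hU, Set.mem_iInter.2 hxU, fun t ht => ?_⟩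
  obtain ⟨y, rfl⟩ := exists_base_eq (θ := θ) hn hA t
  have hnorm (j : Fin n) : 3 / 4 < ‖y.hom (v j)‖ := hUv j y (Set.mem_iInter.1 ht j)
  obtain ⟨g, hgp, hg⟩ := exists_starAlgEquiv_of_lines (P := fun i => y.hom (p i))
    (v := fun i => y.hom (v i)) o (fun i => (hsa i).map y.hom)
    (fun i j hij => by simp only [← map_mul, horth hij, map_zero])
    (fun i => ⟨y.hom (X i), by simp only [v, map_mul]⟩) hnorm
  refine ⟨y.conj g, rfl, fun i j => ?_, hgp⟩
  rw [← hg, ← map_polarPart, ← map_polarPart, ← map_star, ← map_mul]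
  rfl

end LocalFrame

/-! ### Central elements and partitions of unity -/

section Central

open scoped Matrix.Norms.L2Operator

open Matrix

variable {A : Type u} [NonUnitalCStarAlgebra A] {n : ℕ}

theorem exists_mul_mul_ne_zero {a b : M n} (ha : a ≠ 0) (hb : b ≠ 0) : ∃ c, a * c * b ≠ 0 := by
  obtain ⟨i, j, hij⟩ : ∃ i j, a i j ≠ 0 := by
    by_contra! h
    exact ha (Matrix.ext h)
  obtain ⟨k, l, hkl⟩ : ∃ k l, b k l ≠ 0 := by
    by_contra! h
    exact hb (Matrix.ext h)
  refine ⟨single j k 1, fun h => mul_ne_zero hij hkl ?_⟩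
  have hentry : single i i 1 * (a * single j k 1 * b) * single l l 1 =
      single i l (a i j * b k l) := by
    rw [← mul_assoc, ← mul_assoc, single_mul_mul_single, single_mul_mul_single]
    simp
  rw [h, mul_zero, zero_mul, eq_comm] at hentry
  simpa using congrFun₂ hentry i l

section Support

variable (hn : 1 ≤ n) (hA : IsHomogeneous A n)

include hn hA

theorem IsPrimitiveIdeal.exists_notMem {P : TwoSidedIdeal A} (hP : IsPrimitiveIdeal P) :
    ∃ a, a ∉ P := by
  obtain ⟨φ, h0, rfl⟩ := exists_hom_of_isPrimitiveIdeal hn hA hP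
  simpa [TwoSidedIdeal.mem_ker] using DFunLike.ne_iff.1 h0

theorem IsPrimitiveIdeal.exists_mul_mul_notMem {P : TwoSidedIdeal A} (hP : IsPrimitiveIdeal P)
    {a b : A} (ha : a ∉ P) (hb : b ∉ P) : ∃ c, a * c * b ∉ P := by
  obtain ⟨φ, h0, rfl⟩ := exists_hom_of_isPrimitiveIdeal hn hA hP
  simp only [TwoSidedIdeal.mem_ker] at ha hb ⊢
  obtain ⟨m, hm⟩ := exists_mul_mul_ne_zero ha hb
  obtain ⟨c, rfl⟩ := surjective_of_isHomogeneous hA h0 m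
  exact ⟨c, by rwa [map_mul, map_mul]⟩

theorem exists_notMem_of_isOpen {V : Set (PrimitiveSpectrum A)} (hV : IsOpen V) :
    ∀ P ∈ V, ∃ a, a ∉ P.1 ∧ ∀ Q ∉ V, a ∈ Q.1 := by
  induction hV with
  | basic s hs =>
    obtain ⟨a, rfl⟩ := hs
    exact fun P hP => ⟨a, hP, fun Q hQ => not_not.1 hQ⟩
  | univ =>
    intro P _
    obtain ⟨a, ha⟩ := P.2.exists_notMem hn hA
    exact ⟨a, ha, fun Q hQ => absurd (Set.mem_univ Q) hQ⟩
  | inter s t _ _ ihs iht =>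
    intro P hP
    obtain ⟨a, ha, ha'⟩ := ihs P hP.1
    obtain ⟨b, hb, hb'⟩ := iht P hP.2
    obtain ⟨c, hc⟩ := P.2.exists_mul_mul_notMem hn hA ha hb
    refine ⟨a * c * b, hc, fun Q hQ => ?_⟩
    by_cases hQs : Q ∈ s
    · exact Q.1.mul_mem_left _ _ (hb' Q fun h => hQ ⟨hQs, h⟩)
    · exact Q.1.mul_mem_right _ _ (Q.1.mul_mem_right _ _ (ha' Q hQs))
  | sUnion S _ ih =>
    rintro P ⟨s, hs, hP⟩
    obtain ⟨a, ha, ha'⟩ := ih s hs P hP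
    exact ⟨a, ha, fun Q hQ => ha' Q fun h => hQ ⟨s, hs, h⟩⟩

end Support

variable {T : Type v} [TopologicalSpace T] {θ : T ≃ₜ PrimitiveSpectrum A}

namespace MatrixRep

theorem exists_hom_eq_single_of_isOpen (hn : 1 ≤ n) (hA : IsHomogeneous A n) (x : MatrixRep θ n)
    {U : Set T} (hU : IsOpen U) (hx : x.base ∈ U) (i j : Fin n) :
    ∃ d, x.hom d = single i j 1 ∧ ∀ y : MatrixRep θ n, y.base ∉ U → y.hom d = 0 := by
  obtain ⟨a, ha, hoff⟩ := exists_notMem_of_isOpen hn hA (hU.preimage θ.symm.continuous) (θ x.base)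
    (by simpa using hx)
  rw [← hom_eq_zero_iff] at ha
  obtain ⟨k, l, hkl⟩ : ∃ k l, x.hom a k l ≠ 0 := by
    by_contra! h
    exact ha (Matrix.ext h)
  obtain ⟨b, hb⟩ := x.surjective hA (single i k (x.hom a k l)⁻¹)
  obtain ⟨c, hc⟩ := x.surjective hA (single l j 1)
  refine ⟨b * a * c, ?_, fun y hy => ?_⟩
  · rw [map_mul, map_mul, hb, hc, single_mul_mul_single, inv_mul_cancel₀ hkl, one_mul]
  · rw [map_mul, map_mul, (y.hom_eq_zero_iff a).2 (hoff _ (by simpa using hy)), mul_zero, zero_mul]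

theorem exists_isSelfAdjoint_hom_eq (x : MatrixRep θ n) {B : NonUnitalStarSubalgebra ℂ A} {m : M n}
    (hm : IsSelfAdjoint m) (hB : m ∈ x.hom '' (B : Set A)) :
    ∃ h ∈ B, IsSelfAdjoint h ∧ x.hom h = m := by
  obtain ⟨b, hb, rfl⟩ := hB
  refine ⟨(1 / 2 : ℂ) • (b + star b), SMulMemClass.smul_mem _ (add_mem hb (star_mem hb)), ?_, ?_⟩
  · refine IsSelfAdjoint.smul ?_ (.add_star_self b)
    simp [isSelfAdjoint_iff]
  · rw [map_smul, map_add, map_star, hm.star_eq, ← two_smul ℂ, smul_smul]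
    norm_num

/-- The pairwise orthogonal elements are obtained from a lift of the diagonal matrix with entries
`1, …, n` by functional calculus. -/
theorem exists_orthogonal_lift (x : MatrixRep θ n) {B : NonUnitalStarSubalgebra ℂ A}
    (hB : IsClosed (B : Set A)) (hx : diag n ⊆ x.hom '' (B : Set A)) :
    ∃ p : Fin n → A, (∀ i, p i ∈ B) ∧ (∀ i, IsSelfAdjoint (p i)) ∧
      (Pairwise fun i j => p i * p j = 0) ∧ ∀ i, x.hom (p i) = single i i 1 := by
  let m : M n := diagonalHom n fun i => ((i + 1 : ℝ) : ℂ)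
  have hm : IsSelfAdjoint m := .map (funext fun i => Complex.conj_ofReal _) (diagonalHom n)
  obtain ⟨h, hhB, hh, hxh⟩ := x.exists_isSelfAdjoint_hom_eq hm (hx (isDiag_diagonal _))
  refine ⟨fun i => cfcₙ (bump 1 i) h, fun i => ?_, fun i => cfcₙ_predicate _ h, fun i j hij => ?_,
    fun i => ?_⟩
  · have : IsClosed (B : Set A) := hB
    exact cfcₙ_mem (𝕜' := ℂ) (bump 1 i) hhB
  · exact cfcₙ_bump_mul_of_ne h (Fin.val_ne_of_ne hij) (by norm_num) (by norm_num) (by norm_num)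
  · rw [map_cfcₙ_real _ (continuous_bump 1 i) (bump_zero (by norm_num)) hh, hxh,
      cfcₙ_bump_hom_pi _ le_rfl (by norm_num)]
    exact diagonal_single i 1

/-- If `e` is a local system of matrix units and the value of `d` is a rank one projection, then
`∑ i, e i o * d * e o i` is the identity. -/
theorem exists_scalar_of_isOpen (hn : 1 ≤ n) (hA : IsHomogeneous A n) {U : Set T} (hU : IsOpen U)
    {t : T} (ht : t ∈ U) :
    ∃ z : A, (∀ y : MatrixRep θ n, ∃ c : ℂ, y.hom z = c • (1 : M n)) ∧
      ∀ y : MatrixRep θ n, (y.base = t → y.hom z = 1) ∧ (y.base ∉ U → y.hom z = 0) := by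
  let o : Fin n := ⟨0, hn⟩
  obtain ⟨x, rfl⟩ := exists_base_eq (θ := θ) hn hA t
  obtain ⟨p, -, hp, horth, hxp⟩ := x.exists_orthogonal_lift (B := ⊤) isClosed_univ fun m _ =>
    let ⟨a, ha⟩ := x.surjective hA m
    ⟨a, trivial, ha⟩
  obtain ⟨e, V, hV, hxV, hunits⟩ := x.exists_isOpen_matrixUnits hn hA hp horth hxp
  obtain ⟨x', hx', hx'e, -⟩ := hunits x.base hxV
  obtain ⟨d, hd, hoff⟩ := x'.exists_hom_eq_single_of_isOpen hn hA (hU.inter hV)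
    (by rw [hx']; exact ⟨ht, hxV⟩) o o
  let z : A := ∑ i, e i o * d * e o i
  have hunital (y : MatrixRep θ n) (hy : ∀ i j, y.hom (e i j) = single i j 1) :
      y.hom z = y.hom d o o • (1 : M n) := by
    have : (1 : M n) = ∑ i, single i i 1 := sum_single_one.symm
    simp only [z, map_sum, map_mul, hy, single_mul_mul_single, one_mul, mul_one, this,
      Finset.smul_sum, smul_single, smul_eq_mul]
  have hzero (y : MatrixRep θ n) (hy : y.base ∉ U ∩ V) : y.hom z = 0 := by
    simp [z, hoff y hy]
  refine ⟨z, fun y => ?_, fun y => ⟨fun hy => ?_, fun hy => hzero y fun h => hy h.1⟩⟩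
  · by_cases hy : y.base ∈ U ∩ V
    · obtain ⟨y', hy', hy'e, -⟩ := hunits y.base hy.2
      obtain ⟨g, hg⟩ := exists_equiv hA hy'
      exact ⟨y'.hom d o o, by rw [← hg, hunital y' hy'e, map_smul, map_one]⟩
    · exact ⟨0, by rw [hzero y hy, zero_smul]⟩
  · obtain ⟨g, hg⟩ := exists_equiv hA (hx'.trans hy.symm)
    rw [← hg, hunital x' hx'e, hd, single_apply_same, one_smul, map_one]

end MatrixRep

/-- The element `z` acts on the fibre over `t` as multiplication by `c t`, that is, `z` is the
central element given by the function `c`. -/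
def IsCentralFunction (θ : T ≃ₜ PrimitiveSpectrum A) (n : ℕ) (z : A) (c : T → ℝ) : Prop :=
  ∀ y : MatrixRep θ n, y.hom z = (c y.base : ℂ) • (1 : M n)

namespace IsCentralFunction

variable {z z' : A} {c c' : T → ℝ}

theorem hom_mul (h : IsCentralFunction θ n z c) (y : MatrixRep θ n) (a : A) :
    y.hom (z * a) = (c y.base : ℂ) • y.hom a := by
  rw [map_mul, h y, smul_mul_assoc, one_mul]

theorem hom_mul' (h : IsCentralFunction θ n z c) (y : MatrixRep θ n) (a : A) :
    y.hom (a * z) = (c y.base : ℂ) • y.hom a := by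
  rw [map_mul, h y, mul_smul_comm, mul_one]

theorem mul (h : IsCentralFunction θ n z c) (h' : IsCentralFunction θ n z' c') :
    IsCentralFunction θ n (z * z') fun t => c t * c' t := fun y => by
  rw [h.hom_mul, h' y, smul_smul, Complex.ofReal_mul]

theorem sum {ι : Type*} {s : Finset ι} {z : ι → A} {c : ι → T → ℝ}
    (h : ∀ i ∈ s, IsCentralFunction θ n (z i) (c i)) :
    IsCentralFunction θ n (∑ i ∈ s, z i) fun t => ∑ i ∈ s, c i t := fun y => by
  rw [map_sum, Finset.sum_congr rfl fun i hi => h i hi y, ← Finset.sum_smul, Complex.ofReal_sum]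

theorem mem_centralizer (hn : 1 ≤ n) (hA : IsHomogeneous A n) (h : IsCentralFunction θ n z c)
    (S : Set A) : z ∈ S.centralizer := fun b _ =>
  MatrixRep.eq_of_forall_hom (θ := θ) hn hA fun y => by rw [h.hom_mul', h.hom_mul]

theorem isSelfAdjoint (hn : 1 ≤ n) (hA : IsHomogeneous A n) (h : IsCentralFunction θ n z c) :
    IsSelfAdjoint z :=
  MatrixRep.eq_of_forall_hom (θ := θ) hn hA fun y => by
    rw [map_star, h y, star_smul, star_one, Complex.star_def, Complex.conj_ofReal]

theorem cfcₙ (hn : 1 ≤ n) (hA : IsHomogeneous A n) (h : IsCentralFunction θ n z c) {f : ℝ → ℝ}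
    (hf : Continuous f) (h0 : f 0 = 0) : IsCentralFunction θ n (cfcₙ f z) (f ∘ c) := fun y => by
  have hscalar (r : ℝ) : ((r : ℝ) : ℂ) • (1 : M n) = algebraMap ℝ (M n) r := by
    rw [Algebra.algebraMap_eq_smul_one, Complex.coe_smul]
  rw [map_cfcₙ_real _ hf h0 (h.isSelfAdjoint hn hA), h y, hscalar,
    cfcₙ_eq_cfc hf.continuousOn h0, cfc_algebraMap, hscalar, Function.comp_apply]

theorem continuous [T2Space T] (hn : 1 ≤ n) (hA : IsHomogeneous A n)
    (h : IsCentralFunction θ n z c) : Continuous c := by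
  rw [(MatrixRep.isQuotientMap_base (θ := θ) hn hA).continuous_iff]
  let o : Fin n := ⟨0, hn⟩
  have hc : c ∘ MatrixRep.base = fun y : MatrixRep θ n => (y.hom z o o).re := by
    funext y
    simp [h y]
  rw [hc]
  exact Complex.continuous_re.comp ((MatrixRep.continuous_hom_apply z).matrix_elem o o)

end IsCentralFunction

section CentralElements

variable (hn : 1 ≤ n) (hA : IsHomogeneous A n)

include hn hA

theorem exists_isCentralFunction_norm_sq {z : A}
    (hz : ∀ y : MatrixRep θ n, ∃ c : ℂ, y.hom z = c • (1 : M n)) :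
    ∃ c : T → ℝ, IsCentralFunction θ n (star z * z) c ∧
      ∀ y : MatrixRep θ n, c y.base = ‖y.hom z‖ ^ 2 := by
  have : Nonempty (Fin n) := ⟨⟨0, hn⟩⟩
  choose x hx using MatrixRep.exists_base_eq (θ := θ) hn hA
  have hnorm (y : MatrixRep θ n) : ‖(x y.base).hom z‖ = ‖y.hom z‖ :=
    MatrixRep.norm_eq hA (hx y.base) z
  refine ⟨fun t => ‖(x t).hom z‖ ^ 2, fun y => ?_, fun y => congrArg (· ^ 2) (hnorm y)⟩
  obtain ⟨c, hc⟩ := hz y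
  simp only [hnorm]
  rw [map_mul, map_star, hc, star_smul, star_one, smul_mul_smul_comm, one_mul, norm_smul,
    norm_one, mul_one, Complex.ofReal_pow, ← Complex.conj_mul', Complex.star_def]

variable (θ)

theorem exists_isCentralFunction_of_isOpen {U : Set T} (hU : IsOpen U) {t : T} (ht : t ∈ U) :
    ∃ (z : A) (c : T → ℝ), IsCentralFunction θ n z c ∧ (∀ u, 0 ≤ c u ∧ c u ≤ 1) ∧ c t = 1 ∧
      ∀ u ∉ U, c u = 0 := by
  have : Nonempty (Fin n) := ⟨⟨0, hn⟩⟩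
  obtain ⟨z, hz, hz'⟩ := MatrixRep.exists_scalar_of_isOpen (θ := θ) hn hA hU ht
  obtain ⟨c, hc, hcz⟩ := exists_isCentralFunction_norm_sq hn hA hz
  refine ⟨_, _, hc.cfcₙ hn hA (f := fun r => min r 1) (by fun_prop) (by simp), fun u => ?_, ?_,
    fun u hu => ?_⟩
  · obtain ⟨y, rfl⟩ := MatrixRep.exists_base_eq (θ := θ) hn hA u
    exact ⟨le_min ((sq_nonneg _).trans_eq (hcz y).symm) zero_le_one, min_le_right _ _⟩
  · obtain ⟨y, rfl⟩ := MatrixRep.exists_base_eq (θ := θ) hn hA t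
    simp [hcz, (hz' y).1 rfl]
  · obtain ⟨y, rfl⟩ := MatrixRep.exists_base_eq (θ := θ) hn hA u
    simp [hcz, (hz' y).2 hu]

end CentralElements

/-- A continuous function vanishing at `0` and with the value `r⁻¹` at every `r ≥ 1 / 2`. -/
def cutInv (r : ℝ) : ℝ := r * (max r (1 / 2) ^ 2)⁻¹

theorem continuous_cutInv : Continuous cutInv :=
  continuous_id.mul <| Continuous.inv₀ (by fun_prop) fun r =>
    pow_ne_zero 2 (lt_max_of_lt_right (by norm_num : (0 : ℝ) < 1 / 2)).ne'

theorem cutInv_zero : cutInv 0 = 0 := zero_mul _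

theorem cutInv_nonneg {r : ℝ} (hr : 0 ≤ r) : 0 ≤ cutInv r := by
  unfold cutInv
  positivity

theorem mul_cutInv_le_one {r : ℝ} (hr : 0 ≤ r) : r * cutInv r ≤ 1 := by
  rw [cutInv, ← mul_assoc, ← sq, ← div_eq_mul_inv]
  exact div_le_one_of_le₀ (pow_le_pow_left₀ hr (le_max_left _ _) 2) (sq_nonneg _)

theorem mul_cutInv_of_half_le {r : ℝ} (hr : 1 / 2 ≤ r) : r * cutInv r = 1 := by
  have : r ≠ 0 := by linarith
  rw [cutInv, max_eq_left hr, ← mul_assoc, ← sq, mul_inv_cancel₀ (pow_ne_zero 2 this)]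

theorem exists_partition [T2Space T] (θ : T ≃ₜ PrimitiveSpectrum A) (hn : 1 ≤ n)
    (hA : IsHomogeneous A n) {K : Set T} (hK : IsCompact K) {V : T → Set T}
    (hV : ∀ t, IsOpen (V t)) (hVt : ∀ t, t ∈ V t) :
    ∃ (s : Finset T) (z : T → A) (c : T → T → ℝ), (∀ t, IsCentralFunction θ n (z t) (c t)) ∧
      (∀ t u, 0 ≤ c t u) ∧ (∀ t, ∀ u ∉ V t, c t u = 0) ∧
      (∀ u, ∑ t ∈ s, c t u ≤ 1) ∧ ∀ u ∈ K, ∑ t ∈ s, c t u = 1 := by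
  choose z c hz hc hct hcV using fun t =>
    exists_isCentralFunction_of_isOpen θ hn hA (hV t) (hVt t)
  obtain ⟨s, -, hs⟩ := hK.elim_nhds_subcover (fun t => {u | 1 / 2 < c t u}) fun t _ =>
    (isOpen_Ioi.preimage ((hz t).continuous hn hA)).mem_nhds (by simp [hct]; norm_num)
  let S : T → ℝ := fun u => ∑ t ∈ s, c t u
  have hS (u : T) : 0 ≤ S u := Finset.sum_nonneg fun t _ => (hc t u).1
  have hSz : IsCentralFunction θ n (∑ t ∈ s, z t) S := .sum fun t _ => hz t
  have hsum (u : T) : ∑ t ∈ s, c t u * cutInv (S u) = S u * cutInv (S u) :=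
    (Finset.sum_mul ..).symm
  refine ⟨s, _, _, fun t => (hz t).mul (hSz.cfcₙ hn hA continuous_cutInv cutInv_zero),
    fun t u => mul_nonneg (hc t u).1 (cutInv_nonneg (hS u)), fun t u hu => by simp [hcV t u hu],
    fun u => (hsum u).trans_le (mul_cutInv_le_one (hS u)), fun u hu => (hsum u).trans ?_⟩
  obtain ⟨t, ht, hut⟩ := Set.mem_iUnion₂.1 (hs hu)
  exact mul_cutInv_of_half_le
    (hut.le.trans (Finset.single_le_sum (fun t _ => (hc t u).1) ht))

/-- A maximal abelian `*`-subalgebra: one that is its own commutant. -/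
def IsMasa (B : NonUnitalStarSubalgebra ℂ A) : Prop :=
  (B : Set A).centralizer = B

namespace IsMasa

variable {B : NonUnitalStarSubalgebra ℂ A}

theorem isClosed (hB : IsMasa B) : IsClosed (B : Set A) := by
  rw [← hB]
  exact Set.isClosed_centralizer _

theorem mul_comm (hB : IsMasa B) {a b : A} (ha : a ∈ B) (hb : b ∈ B) : a * b = b * a :=
  (show b ∈ (B : Set A).centralizer by rwa [hB]) a ha

theorem mem_of_forall_mul_comm (hB : IsMasa B) {a : A} (h : ∀ b ∈ B, b * a = a * b) : a ∈ B :=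
  hB.subset h

theorem mem_of_isCentralFunction (hB : IsMasa B) (hn : 1 ≤ n) (hA : IsHomogeneous A n) {z : A}
    {c : T → ℝ} (hz : IsCentralFunction θ n z c) : z ∈ B :=
  hB.subset (hz.mem_centralizer hn hA _)

end IsMasa

theorem IsCartanSubalgebra.isMasa {B : NonUnitalStarSubalgebra ℂ A}
    (hB : IsCartanSubalgebra B) : IsMasa B :=
  Set.ext fun a => ⟨fun h => (hB.maximalAbelian a).2 fun b hb => (h b hb).symm,
    fun h b hb => ((hB.maximalAbelian a).1 h b hb).symm⟩

theorem IsConditionalExpectation.hom_eq_zero [T2Space T] {B : NonUnitalStarSubalgebra ℂ A}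
    {E : A →ₗ[ℂ] A} (hE : IsConditionalExpectation B E) (hn : 1 ≤ n) (hA : IsHomogeneous A n)
    (hB : IsMasa B) (x : MatrixRep θ n) {a : A} (ha : x.hom a = 0) : x.hom (E a) = 0 := by
  refine norm_le_zero_iff.1 (le_of_forall_pos_le_add fun ε hε => ?_)
  rw [zero_add]
  obtain ⟨z, c, hz, hc, hcx, hcU⟩ := exists_isCentralFunction_of_isOpen θ hn hA
    (MatrixRep.isOpen_norm_lt (θ := θ) hn hA a ε) (t := x.base)
    fun y hy => by rwa [y.norm_eq hA hy, ha, norm_zero]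
  have hzB := hB.mem_of_isCentralFunction hn hA hz
  have hcut : ‖z * a * z‖ ≤ ε := by
    refine MatrixRep.norm_le_of_forall_hom (θ := θ) hn hA hε.le fun y => ?_
    obtain ⟨h0, h1⟩ := hc y.base
    rw [hz.hom_mul', hz.hom_mul, norm_smul, norm_smul, Complex.norm_real, Real.norm_of_nonneg h0]
    by_cases hy : y.base ∈ {t | ∀ x : MatrixRep θ n, x.base = t → ‖x.hom a‖ < ε}
    · have hca := mul_le_of_le_one_left (norm_nonneg (y.hom a)) h1
      exact (mul_le_of_le_one_left (by positivity) h1).trans (hca.trans (hy y rfl).le)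
    · rw [hcU _ hy, zero_mul]
      exact hε.le
  calc ‖x.hom (E a)‖ = ‖x.hom (E (z * a * z))‖ := by
        rw [hE.map_mul_mul z hzB z hzB, hz.hom_mul', hz.hom_mul, hcx, Complex.ofReal_one, one_smul,
          one_smul]
    _ ≤ ‖E (z * a * z)‖ := NonUnitalStarAlgHom.norm_apply_le x.hom _
    _ ≤ ε := (hE.contractive _).trans hcut

end Central

/-! ### The fibres of a maximal abelian subalgebra -/

section Fibres

open scoped Matrix.Norms.L2Operator

open Matrix WeakDual

theorem eq_sum_mul_mul {ι R : Type*} [Fintype ι] [Semiring R] {p : ι → R} {m : R}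
    (hp : ∀ i, IsIdempotentElem (p i)) (hsum : ∑ i, p i = 1) (hm : ∀ i, p i * m = m * p i) :
    m = ∑ i, p i * m * p i := by
  simp only [hm, mul_assoc, (hp _).eq]
  rw [← Finset.mul_sum, hsum, mul_one]

theorem exists_starAlgHom_pi_surjective (C : Type*) [CommCStarAlgebra C] [FiniteDimensional ℂ C] :
    ∃ (k : ℕ) (ψ : (Fin k → ℂ) →⋆ₐ[ℂ] C), Function.Surjective ψ := by
  have : Finite (characterSpace ℂ C) := .of_equiv _ CharacterSpace.equivAlgHom.symm
  obtain ⟨k, ⟨e⟩⟩ := Finite.exists_equiv_fin (characterSpace ℂ C)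
  let ι : (Fin k → ℂ) →⋆ₐ[ℂ] C(characterSpace ℂ C, ℂ) :=
    { toFun := fun l => ⟨l ∘ e, continuous_of_discreteTopology⟩
      map_one' := rfl
      map_mul' := fun _ _ => rfl
      map_zero' := rfl
      map_add' := fun _ _ => rfl
      commutes' := fun _ => rfl
      map_star' := fun _ => rfl }
  have hι : Function.Surjective ι := fun f =>
    ⟨f ∘ e.symm, ContinuousMap.ext fun χ => congrArg f (e.symm_apply_apply χ)⟩
  exact ⟨k, (gelfandStarTransform C).symm.toStarAlgHom.comp ι,
    (gelfandStarTransform C).symm.surjective.comp hι⟩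

variable {n : ℕ}

theorem mul_comm_of_mem_diag {m m' : M n} (hm : m ∈ diag n) (hm' : m' ∈ diag n) :
    m * m' = m' * m := by
  rw [← IsDiag.diagonal_diag hm, ← IsDiag.diagonal_diag hm', diagonal_mul_diagonal,
    diagonal_mul_diagonal]
  simp only [mul_comm]

theorem exists_hom_pi_range {C : NonUnitalStarSubalgebra ℂ (M n)} (h1 : 1 ∈ C)
    (hC : ∀ a ∈ C, ∀ b ∈ C, a * b = b * a) :
    ∃ (k : ℕ) (ψ : (Fin k → ℂ) →⋆ₙₐ[ℂ] M n), ψ 1 = 1 ∧ Set.range ψ = C := by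
  let _ : CStarAlgebra (M n) := {}
  let S := C.toStarSubalgebra h1
  have : IsClosed (S : Set (M n)) := Submodule.closed_of_finiteDimensional C.toSubmodule
  have : FiniteDimensional ℂ S.toSubalgebra.toSubmodule := inferInstance
  have : FiniteDimensional ℂ S := this
  let _ : CommCStarAlgebra S :=
    { (inferInstance : CStarAlgebra S) with
      mul_comm := fun a b => Subtype.ext (hC a a.2 b b.2) }
  obtain ⟨k, ψ, hψ⟩ := exists_starAlgHom_pi_surjective S
  exact ⟨k, (S.subtype.comp ψ : (Fin k → ℂ) →⋆ₐ[ℂ] M n), map_one (S.subtype.comp ψ),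
    (hψ.range_comp Subtype.val).trans Subtype.range_coe⟩

theorem hom_pi_eq_sum {k : ℕ} (ψ : (Fin k → ℂ) →⋆ₙₐ[ℂ] M n) (l : Fin k → ℂ) :
    ψ l = ∑ j, l j • ψ (Pi.single j 1) := by
  conv_lhs => rw [pi_eq_sum_univ' l]
  simp only [map_sum, map_smul]

theorem isSelfAdjoint_hom_pi {k : ℕ} (ψ : (Fin k → ℂ) →⋆ₙₐ[ℂ] M n) (d : Fin k → ℝ) :
    IsSelfAdjoint (ψ fun j => (d j : ℂ)) :=
  .map (funext fun _ => Complex.conj_ofReal _) ψ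

/-- The spectral theorem diagonalizes the image of `(1, …, k)`, which generates the range. -/
theorem exists_starAlgEquiv_hom_pi_mem_diag {k : ℕ} (ψ : (Fin k → ℂ) →⋆ₙₐ[ℂ] M n) :
    ∃ g : M n ≃⋆ₐ[ℂ] M n, ∀ l, g (ψ l) ∈ diag n := by
  let h := ψ fun j => ((j + 1 : ℝ) : ℂ)
  have hh : IsSelfAdjoint h := isSelfAdjoint_hom_pi ψ _
  have hherm : h.IsHermitian := hh
  let g := (Unitary.conjStarAlgAut ℂ _ hherm.eigenvectorUnitary).symm
  have hgh : g h = diagonalHom n fun i => (hherm.eigenvalues i : ℂ) :=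
    (StarAlgEquiv.symm_apply_eq _).2 hherm.spectral_theorem
  have hsingle (j : Fin k) : g (ψ (Pi.single j 1)) ∈ diag n := by
    have hf := continuous_bump 1 j
    have h0 := bump_zero (w := 1) (j := j) (by norm_num)
    rw [← cfcₙ_bump_hom_pi ψ le_rfl (by norm_num) j]
    have : g (cfcₙ (bump 1 j) h) = cfcₙ (bump 1 j) (g h) :=
      map_cfcₙ_real (g.toNonUnitalStarAlgHom) hf h0 hh
    rw [this, hgh, cfcₙ_hom_pi _ hf h0]
    exact isDiag_diagonal _
  refine ⟨g, fun l i j hij => ?_⟩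
  change g (ψ l) i j = 0
  rw [hom_pi_eq_sum, map_sum, Matrix.sum_apply]
  refine Finset.sum_eq_zero fun m _ => ?_
  rw [map_smul, Matrix.smul_apply, hsingle m hij, smul_zero]

theorem isOpen_span_range_eq_top (ι : Type*) (F : Type*) [NormedAddCommGroup F] [NormedSpace ℂ F]
    [FiniteDimensional ℂ F] : IsOpen {f : ι → F | Submodule.span ℂ (Set.range f) = ⊤} := by
  refine isOpen_iff_mem_nhds.2 fun f hf => ?_
  obtain ⟨κ, a, -, hspan, hli⟩ := exists_linearIndependent' ℂ f
  rw [show Submodule.span ℂ (Set.range f) = ⊤ from hf] at hspan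
  have := hli.finite_of_isNoetherian
  let _ := Fintype.ofFinite κ
  have hcard : Fintype.card κ = Module.finrank ℂ F :=
    (Module.finrank_eq_card_basis (.mk hli hspan.ge)).symm
  have hcont : Continuous fun f' : ι → F => f' ∘ a := continuous_pi fun i => continuous_apply (a i)
  have hopen : IsOpen {f' : ι → F | LinearIndependent ℂ (f' ∘ a)} :=
    (isOpen_setOfPred_linearIndependent (𝕜 := ℂ) (E := F) (ι := κ)).preimage hcont
  filter_upwards [hopen.mem_nhds hli] with f' hf'
  refine eq_top_iff.2 ?_
  rw [← LinearIndependent.span_eq_top_of_card_eq_finrank' hf' hcard]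
  exact Submodule.span_mono (Set.range_comp_subset_range a f')

variable {A : Type u} [NonUnitalCStarAlgebra A] {T : Type v} [TopologicalSpace T]
  {θ : T ≃ₜ PrimitiveSpectrum A} (hn : 1 ≤ n) (hA : IsHomogeneous A n)
  {B : NonUnitalStarSubalgebra ℂ A}

include hA in
theorem MatrixRep.span_image_eq_top_of_base_eq {x y : MatrixRep θ n} (h : x.base = y.base)
    {S : Set A} (hx : Submodule.span ℂ (x.hom '' S) = ⊤) :
    Submodule.span ℂ (y.hom '' S) = ⊤ := by
  obtain ⟨g, hg⟩ := exists_equiv hA h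
  let g' : M n →ₗ[ℂ] M n := g.toAlgEquiv.toLinearEquiv
  have himage : y.hom '' S = g' '' (x.hom '' S) := by
    rw [Set.image_image]
    exact Set.image_congr fun a _ => (hg a).symm
  rw [himage, Submodule.span_image, hx, Submodule.map_top]
  exact LinearMap.range_eq_top.2 g.surjective

include hn hA

theorem IsMasa.one_mem_image (hB : IsMasa B) (x : MatrixRep θ n) : 1 ∈ x.hom '' (B : Set A) := by
  obtain ⟨z, c, hz, -, hc, -⟩ :=
    exists_isCentralFunction_of_isOpen θ hn hA isOpen_univ (Set.mem_univ x.base)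
  exact ⟨z, hB.mem_of_isCentralFunction hn hA hz, by rw [hz, hc, Complex.ofReal_one, one_smul]⟩

theorem IsMasa.exists_hom_pi_range (hB : IsMasa B) (x : MatrixRep θ n) :
    ∃ (k : ℕ) (ψ : (Fin k → ℂ) →⋆ₙₐ[ℂ] M n), ψ 1 = 1 ∧ Set.range ψ = x.hom '' (B : Set A) := by
  refine HomCartan.exists_hom_pi_range (C := B.map x.hom) (hB.one_mem_image hn hA x) ?_
  rintro _ ⟨a, ha, rfl⟩ _ ⟨b, hb, rfl⟩
  exact (map_mul x.hom a b).symm.trans ((congrArg x.hom (hB.mul_comm ha hb)).trans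
    (map_mul x.hom b a))

variable [T2Space T]

theorem MatrixRep.isOpen_span_image_eq_top (θ : T ≃ₜ PrimitiveSpectrum A) (S : Set A) :
    IsOpen {t | ∀ y : MatrixRep θ n, y.base = t → Submodule.span ℂ (y.hom '' S) = ⊤} := by
  refine isOpen_forall_base_eq hn hA ?_ fun y y' h hy => span_image_eq_top_of_base_eq hA h hy
  simp only [Set.image_eq_range]
  exact (isOpen_span_range_eq_top S (M n)).preimage (f := fun (y : MatrixRep θ n) (a : S) =>
    y.hom a) (continuous_pi fun a => continuous_hom_apply (a : A))

/-- Together with the kernel of `E`, the set `S` spans the fibre of `A` at `x`, hence also the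
nearby fibres, and `E` acts on these. -/
theorem IsMasa.exists_isOpen_image_subset_span (hB : IsMasa B) {E : A →ₗ[ℂ] A}
    (hE : IsConditionalExpectation B E) (x : MatrixRep θ n) {S : Set A} (hSB : S ⊆ B)
    (hS : x.hom '' (B : Set A) ⊆ Submodule.span ℂ (x.hom '' S)) :
    ∃ U, IsOpen U ∧ x.base ∈ U ∧ ∀ y : MatrixRep θ n, y.base ∈ U →
      y.hom '' (B : Set A) ⊆ Submodule.span ℂ (y.hom '' S) := by
  let S' : Set A := S ∪ LinearMap.ker E
  have hE' (a : A) (ha : a ∈ Submodule.span ℂ S') : E a ∈ Submodule.span ℂ S := by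
    refine Submodule.span_le.2 (?_ : S' ⊆ (Submodule.span ℂ S).comap E) ha
    refine Set.union_subset (fun s hs => ?_) fun a ha => ?_
    · rw [SetLike.mem_coe, Submodule.mem_comap, hE.map_of_mem s (hSB hs)]
      exact Submodule.subset_span hs
    · rw [SetLike.mem_coe, Submodule.mem_comap, LinearMap.mem_ker.1 ha]
      exact zero_mem _
  have hmem_span (y : MatrixRep θ n) (hy : Submodule.span ℂ (y.hom '' S') = ⊤) :
      y.hom '' (B : Set A) ⊆ Submodule.span ℂ (y.hom '' S) := by
    rintro _ ⟨b, hb, rfl⟩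
    have hyb : y.hom b ∈ Submodule.span ℂ ((y.hom : A →ₗ[ℂ] M n) '' S') := hy ▸ trivial
    rw [Submodule.span_image] at hyb
    obtain ⟨a, ha, hab : y.hom a = y.hom b⟩ := hyb
    have hEab : y.hom (E a) = y.hom b := by
      rw [← sub_eq_zero, ← map_sub] at hab ⊢
      rw [← hE.map_of_mem b hb, ← map_sub]
      exact hE.hom_eq_zero hn hA hB y hab
    rw [← hEab]
    exact Submodule.span_image (y.hom : A →ₗ[ℂ] M n) ▸ Submodule.mem_map_of_mem (hE' a ha)
  have hx : Submodule.span ℂ (x.hom '' S') = ⊤ := by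
    refine Submodule.eq_top_iff'.2 fun m => ?_
    obtain ⟨a, rfl⟩ := x.surjective hA m
    rw [← add_sub_cancel (E a) a, map_add]
    refine add_mem (Submodule.span_mono (Set.image_mono Set.subset_union_left)
      (hS ⟨E a, hE.map_mem a, rfl⟩)) (Submodule.subset_span ⟨a - E a, Or.inr ?_, rfl⟩)
    rw [SetLike.mem_coe, LinearMap.mem_ker, map_sub, hE.map_of_mem _ (hE.map_mem a), sub_self]
  exact ⟨_, MatrixRep.isOpen_span_image_eq_top hn hA θ S',
    fun y hy => MatrixRep.span_image_eq_top_of_base_eq hA hy.symm hx,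
    fun y hy => hmem_span y (hy y rfl)⟩

/-- If `f` acts on the generators `S` of the nearby fibres of `B` by `0` or `1`, then the elements
of the corner `f A f` commute with these fibres. -/
theorem IsMasa.hom_corner_mem (hB : IsMasa B) {E : A →ₗ[ℂ] A}
    (hE : IsConditionalExpectation B E) (x : MatrixRep θ n) {S : Set A} (hSB : S ⊆ B)
    (hS : x.hom '' (B : Set A) ⊆ Submodule.span ℂ (x.hom '' S)) {f : A} (hf : f ∈ B)
    (hfS : ∀ s ∈ S, f * s = f ∨ f * s = 0) (a : A) : x.hom (f * a * f) ∈ x.hom '' (B : Set A) := by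
  obtain ⟨U, hU, hxU, hspan⟩ := hB.exists_isOpen_image_subset_span hn hA hE x hSB hS
  obtain ⟨z, c, hz, -, hcx, hcU⟩ := exists_isCentralFunction_of_isOpen θ hn hA hU hxU
  have hcomm (s : A) (hs : s ∈ S) : s * (f * a * f) = f * a * f * s := by
    have hsf := hB.mul_comm (hSB hs) hf
    rw [mul_assoc, mul_assoc, mul_assoc, ← mul_assoc s, hsf]
    rcases hfS s hs with h | h <;> rw [h]
    rw [mul_zero, mul_zero, zero_mul]
  have hcomm' (y : MatrixRep θ n) (hy : y.base ∈ U) (b : A) (hb : b ∈ B) :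
      y.hom b * y.hom (f * a * f) = y.hom (f * a * f) * y.hom b := by
    have hcentralizer : Submodule.span ℂ (y.hom '' S) ≤
        Subalgebra.toSubmodule (Subalgebra.centralizer ℂ {y.hom (f * a * f)}) := by
      rw [Submodule.span_le]
      rintro _ ⟨s, hs, rfl⟩
      refine (Subalgebra.mem_centralizer_iff ℂ).2 ?_
      rintro _ rfl
      rw [← map_mul, ← hcomm s hs, map_mul]
    exact ((Subalgebra.mem_centralizer_iff ℂ).1
      (hcentralizer (hspan y hy ⟨b, hb, rfl⟩)) _ rfl).symm
  refine ⟨z * (f * a * f), hB.mem_of_forall_mul_comm fun b hb => ?_, ?_⟩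
  · refine MatrixRep.eq_of_forall_hom (θ := θ) hn hA fun y => ?_
    rw [map_mul, hz.hom_mul, map_mul y.hom (z * _), hz.hom_mul, mul_smul_comm, smul_mul_assoc]
    by_cases hy : y.base ∈ U
    · rw [hcomm' y hy b hb]
    · rw [hcU _ hy, Complex.ofReal_zero, zero_smul, zero_smul]
  · rw [hz.hom_mul, hcx, Complex.ofReal_one, one_smul]

/-- The corners used are those of the elements of `B` that lift the minimal projections of the
fibre of `B`, and a matrix commuting with these projections is the sum of its corners. -/
theorem IsMasa.centralizer_image_subset (hB : IsMasa B) {E : A →ₗ[ℂ] A}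
    (hE : IsConditionalExpectation B E) (x : MatrixRep θ n) :
    (x.hom '' (B : Set A)).centralizer ⊆ x.hom '' (B : Set A) := by
  intro m hm
  obtain ⟨a, rfl⟩ := x.surjective hA m
  obtain ⟨k, ψ, h1, hψ⟩ := hB.exists_hom_pi_range hn hA x
  obtain ⟨h, hhB, hh, hxh⟩ := x.exists_isSelfAdjoint_hom_eq
    (isSelfAdjoint_hom_pi ψ fun j => j + 1) (hψ ▸ Set.mem_range_self _)
  let f (w : ℝ) (j : Fin k) : A := cfcₙ (bump w j) h
  have hfB (w : ℝ) (j : Fin k) : f w j ∈ B := by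
    have := hB.isClosed
    exact cfcₙ_mem (𝕜' := ℂ) (bump w j) hhB
  have hxf {w : ℝ} (hw : 1 ≤ w) (hw' : w ≤ 4) (j : Fin k) :
      x.hom (f w j) = ψ (Pi.single j 1) := by
    rw [map_cfcₙ_real _ (continuous_bump w j) (bump_zero hw') hh, hxh, cfcₙ_bump_hom_pi ψ hw hw']
  have hspan : x.hom '' (B : Set A) ⊆ Submodule.span ℂ (x.hom '' Set.range (f 2)) := by
    rw [← hψ]
    rintro _ ⟨l, rfl⟩
    rw [hom_pi_eq_sum]
    exact sum_mem fun j _ => Submodule.smul_mem _ _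
      (Submodule.subset_span ⟨f 2 j, ⟨j, rfl⟩, hxf (by norm_num) (by norm_num) j⟩)
  have hcorner (j : Fin k) : x.hom (f 1 j * a * f 1 j) ∈ x.hom '' (B : Set A) := by
    refine hB.hom_corner_mem hn hA hE x (Set.range_subset_iff.2 (hfB 2)) hspan (hfB 1 j) ?_ a
    rintro _ ⟨i, rfl⟩
    rcases eq_or_ne j i with rfl | hij
    · left
      simpa [f, one_add_one_eq_two] using cfcₙ_bump_mul_add_one (j := j) (w := 1) h (by norm_num)
    · exact .inr (cfcₙ_bump_mul_of_ne h (Fin.val_ne_of_ne hij) (by norm_num) (by norm_num)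
        (by norm_num))
  have hsum : x.hom a = ∑ j, x.hom (f 1 j * a * f 1 j) := by
    simp only [map_mul]
    refine eq_sum_mul_mul (fun j => ?_) ?_ fun j => hm _ ⟨_, hfB 1 j, rfl⟩
    · rw [hxf le_rfl (by norm_num), IsIdempotentElem, ← map_mul, ← Pi.single_mul, one_mul]
    · simp only [← h1, hom_pi_eq_sum ψ 1, hxf le_rfl (by norm_num : (1 : ℝ) ≤ 4), Pi.one_apply,
        one_smul]
  rw [hsum]
  exact sum_mem (S := B.map x.hom) fun j _ => hcorner j

theorem IsMasa.exists_image_eq_diag (hB : IsMasa B) {E : A →ₗ[ℂ] A}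
    (hE : IsConditionalExpectation B E) (x : MatrixRep θ n) :
    ∃ g, (x.conj g).hom '' (B : Set A) = diag n := by
  obtain ⟨k, ψ, -, hψ⟩ := hB.exists_hom_pi_range hn hA x
  obtain ⟨g, hg⟩ := exists_starAlgEquiv_hom_pi_mem_diag ψ
  have hgB (b : A) (hb : b ∈ B) : g (x.hom b) ∈ diag n := by
    obtain ⟨l, hl⟩ : x.hom b ∈ Set.range ψ := hψ ▸ ⟨b, hb, rfl⟩
    exact hl ▸ hg l
  refine ⟨g, Set.Subset.antisymm (Set.image_subset_iff.2 hgB) fun m hm => ?_⟩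
  have hcentralizer : g.symm m ∈ (x.hom '' (B : Set A)).centralizer := by
    rintro _ ⟨b, hb, rfl⟩
    refine EquivLike.injective g ?_
    rw [map_mul, map_mul, StarAlgEquiv.apply_symm_apply, mul_comm_of_mem_diag (hgB b hb) hm]
  obtain ⟨b, hb, hbm⟩ := hB.centralizer_image_subset hn hA hE x hcentralizer
  exact ⟨b, hb, (StarAlgEquiv.eq_symm_apply g).1 hbm⟩

end Fibres

/-! ### Local triviality -/

section PrincipalBundles

variable {G E T : Type*} [Group G] [TopologicalSpace G] [IsTopologicalGroup G] [TopologicalSpace E]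
  [TopologicalSpace T] [MulAction G E] [ContinuousSMul G E] {p : E → T} {s : T → E} {c : E → G}

/-- The trivialization over `U` given by a section `s` of a bundle on whose total space `G` acts,
and by the coordinate `c x` of a point `x` with respect to this section. -/
def trivializationOfSection (hsmul : ∀ (g : G) x, p (g • x) = p x) {U : Set T} (hU : IsOpen U)
    (hp : Continuous p) (hps : ∀ t, p (s t) = t) (hcs : ∀ t (g : G), c (g • s t) = g)
    (hsc : ∀ x, c x • s (p x) = x) (hs : ContinuousOn s U) (hc : ContinuousOn c (p ⁻¹' U)) :
    Bundle.Trivialization G p where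
  toFun x := (p x, c x)
  invFun q := q.2 • s q.1
  source := p ⁻¹' U
  target := U ×ˢ Set.univ
  map_source' _ hx := ⟨hx, trivial⟩
  map_target' q hq := by simpa only [Set.mem_preimage, hsmul, hps] using hq.1
  left_inv' x _ := hsc x
  right_inv' q _ := by simp only [hsmul, hps, hcs]
  open_source := hU.preimage hp
  open_target := hU.prod isOpen_univ
  continuousOn_toFun := hp.continuousOn.prodMk hc
  continuousOn_invFun :=
    continuousOn_snd.smul (hs.comp continuousOn_fst fun _ hq => hq.1)
  baseSet := U
  open_baseSet := hU
  source_eq := rfl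
  target_eq := rfl
  proj_toFun _ _ := rfl

theorem isPrincipalBundle_of_sections (hp : Continuous p)
    (hsmul : ∀ (g : G) x, p (g • x) = p x)
    (h : ∀ t, ∃ U, IsOpen U ∧ t ∈ U ∧ ∃ (s : T → E) (c : E → G), (∀ t, p (s t) = t) ∧
      (∀ t g, c (g • s t) = g) ∧ (∀ x, c x • s (p x) = x) ∧ ContinuousOn s U ∧
      ContinuousOn c (p ⁻¹' U)) : IsPrincipalBundle G p where
  map_smul := hsmul
  locallyTrivial t := by
    obtain ⟨U, hU, htU, s, c, hps, hcs, hsc, hs, hc⟩ := h t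
    refine ⟨trivializationOfSection hsmul hU hp hps hcs hsc hs hc, htU, fun g x _ => ?_⟩
    change c (g • x) = g * c x
    rw [← hcs (p x) (g * c x), mul_smul, hsc]

end PrincipalBundles

section Frames

open scoped Matrix.Norms.L2Operator

open Matrix

variable {A : Type u} [NonUnitalCStarAlgebra A] {T : Type v} [TopologicalSpace T]
  {θ : T ≃ₜ PrimitiveSpectrum A} {n : ℕ} {B : NonUnitalStarSubalgebra ℂ A}

theorem continuous_autMD_apply : Continuous fun p : autMD n × M n => p.1.1 p.2 := by
  refine continuous_matrix fun i j => ?_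
  simp only [fun p : autMD n × M n => autMD_apply p.1 p.2 (i, j)]
  have : Continuous fun p : autMD n × M n => (autMat p.1).mulVec fun q => p.2 q.1 q.2 :=
    ((continuous_autMat n).comp continuous_fst).matrix_mulVec
      (continuous_pi fun q => continuous_snd.matrix_elem q.1 q.2)
  exact (continuous_apply (i, j)).comp this

theorem continuousOn_autMD {X : Type*} [TopologicalSpace X] {f : X → autMD n} {S : Set X}
    (hf : ∀ i j, ContinuousOn (fun x => (f x).1 (single i j 1)) S) : ContinuousOn f S := by
  rw [continuousOn_iff_continuous_domRestrict]
  refine autMD_continuous_of_autMat (continuous_matrix fun p q => ?_)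
  exact (continuousOn_iff_continuous_domRestrict.1 (hf q.1 q.2)).matrix_elem p.1 p.2

namespace Frame

/-- The representation underlying a frame. -/
def toMatrixRep (x : Frame θ n B) : MatrixRep θ n := ⟨x.base, x.hom, x.ker_hom⟩

theorem smul_hom_apply (g : autMD n) (x : Frame θ n B) (a : A) :
    (g • x).hom a = g.1 (x.hom a) := rfl

theorem continuous_iff {X : Type*} [TopologicalSpace X] {f : X → Frame θ n B} :
    Continuous f ↔ Continuous (fun s => (f s).base) ∧ ∀ a, Continuous fun s => (f s).hom a :=
  continuous_induced_rng.trans (continuous_prodMk.trans (and_congr Iff.rfl continuous_pi_iff))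

theorem continuous_base : Continuous (base : Frame θ n B → T) :=
  (continuous_iff.1 continuous_id).1

theorem continuous_hom_apply (a : A) : Continuous fun x : Frame θ n B => x.hom a :=
  (continuous_iff.1 continuous_id).2 a

instance : ContinuousSMul (autMD n) (Frame θ n B) where
  continuous_smul := continuous_iff.2 ⟨continuous_base.comp (f := Prod.snd) continuous_snd, fun a =>
    continuous_autMD_apply.comp
      (continuous_fst.prodMk ((continuous_hom_apply a).comp continuous_snd))⟩

theorem exists_smul_eq {x y : Frame θ n B} (h : x.base = y.base) : ∃ g : autMD n, g • x = y := by
  obtain ⟨g, hg⟩ := exists_starAlgEquiv_of_ker_eq x.surjective y.surjective <| by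
    rw [x.ker_hom, y.ker_hom, h]
  have hdiag : g '' diag n = diag n := by
    rw [← x.image_eq, Set.image_image, ← y.image_eq.trans x.image_eq.symm]
    simp only [hg]
  exact ⟨⟨g, hdiag⟩, Frame.ext h (NonUnitalStarAlgHom.ext hg)⟩

theorem smul_left_injective (x : Frame θ n B) : Function.Injective fun g : autMD n => g • x := by
  intro g g' h
  refine Subtype.ext (StarAlgEquiv.ext fun m => ?_)
  obtain ⟨a, rfl⟩ := x.surjective m
  exact congrArg (fun y : Frame θ n B => y.hom a) h

end Frame

namespace MatrixRep

variable {e : Fin n → Fin n → A}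

theorem eq_of_hom_eq_single (hA : IsHomogeneous A n) {x y : MatrixRep θ n} (h : x.base = y.base)
    (hx : ∀ i j, x.hom (e i j) = single i j 1) (hy : ∀ i j, y.hom (e i j) = single i j 1) :
    x = y := by
  obtain ⟨g, hg⟩ := exists_equiv hA h
  have hid : (g : M n →ₗ[ℂ] M n) = LinearMap.id :=
    ext_linearMap ℂ fun i j => LinearMap.ext_ring <| by
      change g (single i j 1) = single i j 1
      rw [← hx, hg, hy, hx]
  exact MatrixRep.ext h (NonUnitalStarAlgHom.ext fun a =>
    (LinearMap.congr_fun hid (x.hom a)).symm.trans (hg a))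

/-- The representations for which the `e i j` are the matrix units form a compact set, on which the
projection to the base is injective. -/
theorem continuousOn_hom_of_hom_eq_single [T2Space T] (hn : 1 ≤ n) (hA : IsHomogeneous A n)
    {s : T → MatrixRep θ n} {U : Set T} (hs : ∀ t, (s t).base = t)
    (he : ∀ t ∈ U, ∀ i j, (s t).hom (e i j) = single i j 1) (a : A) :
    ContinuousOn (fun t => (s t).hom a) U := by
  let S : Set (A → M n) := {f | ∀ i j, f (e i j) = single i j 1}
  have hS : IsClosed S := by
    simp only [S, Set.ofPred_forall]
    exact isClosed_iInter fun i => isClosed_iInter fun j =>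
      isClosed_eq (continuous_apply _) continuous_const
  have h0 : 0 ∉ S := fun h => by
    let o : Fin n := ⟨0, hn⟩
    simpa using congrFun₂ (h o o) o o
  let K : Set (MatrixRep θ n) := {x | ⇑x.hom ∈ S}
  have : CompactSpace K := isCompact_iff_compactSpace.1 (isCompact_coe_hom_preimage hA hS h0)
  have hembedding : IsClosedEmbedding fun x : K => x.1.base :=
    (continuous_base.comp continuous_subtype_val).isClosedEmbedding fun x y h =>
      Subtype.ext (eq_of_hom_eq_single hA h x.2 y.2)
  let σ : U → K := fun t => ⟨s t, he t t.2⟩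
  have hσ : Continuous σ := by
    rw [hembedding.isInducing.continuous_iff]
    simpa only [Function.comp_def, σ, hs] using continuous_subtype_val
  rw [continuousOn_iff_continuous_domRestrict]
  exact (continuous_hom_apply a).comp (continuous_subtype_val.comp hσ)

end MatrixRep

theorem image_eq_diag_of_hom_eq_single (φ : A →⋆ₙₐ[ℂ] M n)
    (hB : ∀ a ∈ B, ∀ b ∈ B, a * b = b * a) {p : Fin n → A} (hp : ∀ i, p i ∈ B)
    (hφ : ∀ i, ∃ c ≠ 0, φ (p i) = single i i c) : φ '' (B : Set A) = diag n := by
  choose c hc hφ using hφ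
  refine Set.Subset.antisymm ?_ fun m hm => ?_
  · rintro _ ⟨b, hb, rfl⟩ i j hij
    have hcomm : φ b * single i i (c i) = single i i (c i) * φ b := by
      rw [← hφ, ← map_mul, hB b hb _ (hp i), map_mul]
    have hentry := congrFun₂ hcomm i j
    rw [mul_single_apply_of_ne _ _ _ _ _ hij.symm, single_mul_apply_same] at hentry
    exact (mul_eq_zero.1 hentry.symm).resolve_left (hc i)
  · refine ⟨∑ i, (m i i * (c i)⁻¹) • p i,
      sum_mem fun i _ => SMulMemClass.smul_mem _ (hp i), ?_⟩
    conv_rhs => rw [← IsDiag.diagonal_diag hm, ← sum_single_eq_diagonal]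
    rw [map_sum]
    simp only [map_smul, hφ, smul_single, smul_eq_mul, diag_apply, inv_mul_cancel_right₀ (hc _)]

section Cartan

variable [T2Space T] (hn : 1 ≤ n) (hA : IsHomogeneous A n)

include hn hA

theorem Frame.exists_base_eq (hB : IsMasa B) {E : A →ₗ[ℂ] A} (hE : IsConditionalExpectation B E)
    (t : T) : ∃ x : Frame θ n B, x.base = t := by
  obtain ⟨x, rfl⟩ := MatrixRep.exists_base_eq (θ := θ) hn hA t
  obtain ⟨g, hg⟩ := hB.exists_image_eq_diag hn hA hE x
  exact ⟨⟨x.base, (x.conj g).hom, (x.conj g).ker_hom, (x.conj g).surjective hA, hg⟩, rfl⟩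

theorem Frame.exists_local_section (hB : IsMasa B) {E : A →ₗ[ℂ] A}
    (hE : IsConditionalExpectation B E) (t₀ : T) :
    ∃ (e : Fin n → Fin n → A) (U : Set T) (s : T → Frame θ n B), IsOpen U ∧ t₀ ∈ U ∧
      (∀ t, (s t).base = t) ∧ ∀ t ∈ U, ∀ i j, (s t).hom (e i j) = single i j 1 := by
  obtain ⟨x, rfl⟩ := Frame.exists_base_eq (θ := θ) hn hA hB hE t₀
  obtain ⟨p, hpB, hp, horth, hxp⟩ :=
    x.toMatrixRep.exists_orthogonal_lift hB.isClosed x.image_eq.superset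
  obtain ⟨e, U, hU, hxU, he⟩ := x.toMatrixRep.exists_isOpen_matrixUnits hn hA hp horth hxp
  have hframe (t : T) : ∃ y : Frame θ n B, y.base = t ∧
      (t ∈ U → ∀ i j, y.hom (e i j) = single i j 1) := by
    by_cases ht : t ∈ U
    · obtain ⟨y, rfl, hye, hyp⟩ := he t ht
      have hyB := image_eq_diag_of_hom_eq_single y.hom (fun a ha b hb => hB.mul_comm ha hb) hpB hyp
      exact ⟨⟨y.base, y.hom, y.ker_hom, y.surjective hA, hyB⟩, rfl, fun _ => hye⟩
    · obtain ⟨y, hy⟩ := Frame.exists_base_eq (θ := θ) hn hA hB hE t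
      exact ⟨y, hy, fun h => absurd h ht⟩
  choose s hs hse using hframe
  exact ⟨e, U, s, hU, hxU, hs, hse⟩

theorem isPrincipalBundle_frameProj (θ : T ≃ₜ PrimitiveSpectrum A) (hB : IsMasa B)
    {E : A →ₗ[ℂ] A} (hE : IsConditionalExpectation B E) :
    IsPrincipalBundle (autMD n) (frameProj θ n B) := by
  refine isPrincipalBundle_of_sections Frame.continuous_base (fun _ _ => rfl) fun t => ?_
  obtain ⟨e, U, s, hU, htU, hs, he⟩ := Frame.exists_local_section (θ := θ) hn hA hB hE t
  choose c hsc using fun x : Frame θ n B => Frame.exists_smul_eq (hs x.base)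
  have hcs (t : T) (g : autMD n) : c (g • s t) = g := by
    have h := hsc (g • s t)
    rw [show (g • s t).base = t from hs t] at h
    exact (s t).smul_left_injective h
  have hcont (a : A) : ContinuousOn (fun t => (s t).hom a) U :=
    MatrixRep.continuousOn_hom_of_hom_eq_single hn hA (s := fun t => (s t).toMatrixRep) hs he a
  refine ⟨U, hU, htU, s, c, hs, hcs, hsc, ?_, continuousOn_autMD fun i j => ?_⟩
  · rw [continuousOn_iff_continuous_domRestrict, Frame.continuous_iff]
    simp only [continuousOn_iff_continuous_domRestrict] at hcont
    exact ⟨by simpa only [Set.domRestrict_apply, hs] using continuous_subtype_val, hcont⟩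
  · refine (Frame.continuous_hom_apply (e i j)).continuousOn.congr fun x hx => ?_
    rw [← he x.base hx, ← Frame.smul_hom_apply, hsc]

end Cartan

end Frames

/-! ### Isomorphisms of pairs -/

section Transport

variable {A₁ A₂ : Type u} [NonUnitalCStarAlgebra A₁] [NonUnitalCStarAlgebra A₂]

theorem IsPrimitiveIdeal.comap {I : TwoSidedIdeal A₂} (hI : IsPrimitiveIdeal I)
    (Φ : A₁ ≃⋆ₐ[ℂ] A₂) : IsPrimitiveIdeal (I.comap Φ) := by
  obtain ⟨H, i₁, i₂, i₃, π, hπ, rfl⟩ := hI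
  refine ⟨H, i₁, i₂, i₃, π.comp Φ.toNonUnitalStarAlgHom, ⟨fun h => hπ.ne_zero ?_, fun K hK h => ?_⟩,
    ?_⟩
  · ext1 a
    obtain ⟨a, rfl⟩ := EquivLike.surjective Φ a
    exact DFunLike.congr_fun h a
  · refine hπ.eq_bot_or_eq_top K hK fun a v hv => ?_
    obtain ⟨a, rfl⟩ := EquivLike.surjective Φ a
    exact h a v hv
  · ext a
    rw [TwoSidedIdeal.mem_comap, TwoSidedIdeal.mem_ker, TwoSidedIdeal.mem_ker]
    rfl

namespace PrimitiveSpectrum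

/-- The preimage of primitive ideals under an isomorphism. -/
def comap (Φ : A₁ ≃⋆ₐ[ℂ] A₂) (P : PrimitiveSpectrum A₂) : PrimitiveSpectrum A₁ :=
  ⟨P.1.comap Φ, P.2.comap Φ⟩

theorem mem_comap (Φ : A₁ ≃⋆ₐ[ℂ] A₂) (P : PrimitiveSpectrum A₂) (a : A₁) :
    a ∈ (P.comap Φ).1 ↔ Φ a ∈ P.1 :=
  TwoSidedIdeal.mem_comap Φ

theorem continuous_comap (Φ : A₁ ≃⋆ₐ[ℂ] A₂) : Continuous (comap Φ) := by
  rw [continuous_generateFrom_iff]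
  rintro _ ⟨a, rfl⟩
  simp only [Set.preimage_ofPred_eq, mem_comap]
  exact TopologicalSpace.isOpen_generateFrom_of_mem ⟨Φ a, rfl⟩

theorem comap_symm_comap (Φ : A₁ ≃⋆ₐ[ℂ] A₂) (P : PrimitiveSpectrum A₂) :
    (P.comap Φ).comap Φ.symm = P :=
  Subtype.ext <| TwoSidedIdeal.ext fun a => by
    rw [mem_comap, mem_comap, StarAlgEquiv.apply_symm_apply]

/-- An isomorphism of C*-algebras induces a homeomorphism of the primitive spectra. -/
def comapHomeomorph (Φ : A₁ ≃⋆ₐ[ℂ] A₂) : PrimitiveSpectrum A₂ ≃ₜ PrimitiveSpectrum A₁ where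
  toFun := comap Φ
  invFun := comap Φ.symm
  left_inv := comap_symm_comap Φ
  right_inv := comap_symm_comap Φ.symm
  continuous_toFun := continuous_comap Φ
  continuous_invFun := continuous_comap Φ.symm

end PrimitiveSpectrum

variable {T₁ T₂ : Type*} [TopologicalSpace T₁] [TopologicalSpace T₂]
  {θ₁ : T₁ ≃ₜ PrimitiveSpectrum A₁} {θ₂ : T₂ ≃ₜ PrimitiveSpectrum A₂} {n : ℕ}
  {B₁ : NonUnitalStarSubalgebra ℂ A₁} {B₂ : NonUnitalStarSubalgebra ℂ A₂}

/-- Composition of the frames of a subalgebra `B₂` with an isomorphism mapping `B₁` onto `B₂`. -/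
def Frame.comap (Φ : A₁ ≃⋆ₐ[ℂ] A₂) (hΦ : Φ '' (B₁ : Set A₁) = B₂) (x : Frame θ₂ n B₂) :
    Frame θ₁ n B₁ where
  base := θ₁.symm ((θ₂ x.base).comap Φ)
  hom := x.hom.comp Φ.toNonUnitalStarAlgHom
  ker_hom := by
    ext a
    rw [θ₁.apply_symm_apply, PrimitiveSpectrum.mem_comap, ← x.ker_hom, TwoSidedIdeal.mem_ker,
      TwoSidedIdeal.mem_ker]
    rfl
  surjective := x.surjective.comp (EquivLike.surjective Φ)
  image_eq := by
    rw [← x.image_eq, ← hΦ, Set.image_image]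
    rfl

theorem Frame.continuous_comap (Φ : A₁ ≃⋆ₐ[ℂ] A₂) (hΦ : Φ '' (B₁ : Set A₁) = B₂) :
    Continuous (Frame.comap Φ hΦ : Frame θ₂ n B₂ → Frame θ₁ n B₁) :=
  Frame.continuous_iff.2 ⟨θ₁.symm.continuous.comp <| (PrimitiveSpectrum.continuous_comap Φ).comp <|
    θ₂.continuous.comp Frame.continuous_base, fun a => Frame.continuous_hom_apply (Φ a)⟩

theorem Frame.comap_symm_comap (Φ : A₁ ≃⋆ₐ[ℂ] A₂) (hΦ : Φ '' (B₁ : Set A₁) = B₂)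
    (hΦ' : Φ.symm '' (B₂ : Set A₂) = B₁) (x : Frame θ₂ n B₂) :
    Frame.comap Φ.symm hΦ' (Frame.comap (θ₁ := θ₁) Φ hΦ x) = x := by
  refine Frame.ext ?_ (NonUnitalStarAlgHom.ext fun a => congrArg x.hom (Φ.apply_symm_apply a))
  change θ₂.symm ((θ₁ (θ₁.symm ((θ₂ x.base).comap Φ))).comap Φ.symm) = x.base
  rw [θ₁.apply_symm_apply, PrimitiveSpectrum.comap_symm_comap, θ₂.symm_apply_apply]

theorem PairIso.principalBundleIso (θ₁ : T₁ ≃ₜ PrimitiveSpectrum A₁)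
    (θ₂ : T₂ ≃ₜ PrimitiveSpectrum A₂) (n : ℕ) (h : PairIso B₁ B₂) :
    PrincipalBundleIso (autMD n) (frameProj θ₁ n B₁) (frameProj θ₂ n B₂) := by
  obtain ⟨Φ, hΦ⟩ := h
  have hΦ' : Φ.symm '' (B₂ : Set A₂) = B₁ := by
    simp only [← hΦ, Set.image_image, StarAlgEquiv.symm_apply_apply, Set.image_id']
  let F : Frame θ₁ n B₁ ≃ₜ Frame θ₂ n B₂ :=
    { toFun := Frame.comap Φ.symm hΦ'
      invFun := Frame.comap Φ hΦ
      left_inv := Frame.comap_symm_comap Φ.symm hΦ' hΦ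
      right_inv := Frame.comap_symm_comap Φ hΦ hΦ'
      continuous_toFun := Frame.continuous_comap Φ.symm hΦ'
      continuous_invFun := Frame.continuous_comap Φ hΦ }
  exact ⟨F, (θ₁.trans (PrimitiveSpectrum.comapHomeomorph Φ.symm)).trans θ₂.symm, fun _ => rfl,
    fun _ _ => rfl⟩

end Transport

/-! ### Isomorphisms of bundles -/

section Reconstruction

open scoped Matrix.Norms.L2Operator

open Matrix

theorem norm_sum_smul_sub_le {V ι : Type*} [NormedAddCommGroup V] [NormedSpace ℝ V]
    {s : Finset ι} {c : ι → ℝ} {v : ι → V} {w : V} {ε : ℝ} (hc : ∀ i ∈ s, 0 ≤ c i)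
    (hsum : ∑ i ∈ s, c i ≤ 1) (hv : ∀ i ∈ s, c i = 0 ∨ ‖v i - w‖ ≤ ε)
    (hw : ∑ i ∈ s, c i = 1 ∨ ‖w‖ ≤ ε) : ‖∑ i ∈ s, c i • v i - w‖ ≤ ε := by
  have hdecomp : ∑ i ∈ s, c i • v i - w =
      ∑ i ∈ s, c i • (v i - w) - (1 - ∑ i ∈ s, c i) • w := by
    simp only [smul_sub, Finset.sum_sub_distrib, ← Finset.sum_smul, sub_smul, one_smul]
    abel
  have hle : ‖∑ i ∈ s, c i • (v i - w)‖ ≤ ∑ i ∈ s, c i * ε := norm_sum_le_of_le _ fun i hi => by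
    rw [norm_smul, Real.norm_of_nonneg (hc i hi)]
    rcases hv i hi with h | h
    · rw [h, zero_mul, zero_mul]
    · exact mul_le_mul_of_nonneg_left h (hc i hi)
  have hle' : ‖(1 - ∑ i ∈ s, c i) • w‖ ≤ (1 - ∑ i ∈ s, c i) * ε := by
    rw [norm_smul, Real.norm_of_nonneg (sub_nonneg.2 hsum)]
    rcases hw with h | h
    · rw [h, sub_self, zero_mul, zero_mul]
    · exact mul_le_mul_of_nonneg_left h (sub_nonneg.2 hsum)
  calc ‖∑ i ∈ s, c i • v i - w‖ ≤ ∑ i ∈ s, c i * ε + (1 - ∑ i ∈ s, c i) * ε := by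
        rw [hdecomp]
        exact (norm_sub_le _ _).trans (add_le_add hle hle')
    _ = ε := by rw [← Finset.sum_mul]; ring

theorem exists_forall_apply_eq {A : Type*} [NonUnitalCStarAlgebra A] {n : ℕ} {ι : Type*}
    {φ : ι → A →⋆ₙₐ[ℂ] M n} {f : ι → M n}
    (hφ : ∀ (a : A) (c : ℝ), 0 ≤ c → (∀ i, ‖φ i a‖ ≤ c) → ‖a‖ ≤ c)
    (hf : ∀ ε > 0, ∃ a, ∀ i, ‖φ i a - f i‖ ≤ ε) : ∃ a, ∀ i, φ i a = f i := by
  choose a ha using fun k : ℕ => hf (1 / (k + 1)) Nat.one_div_pos_of_nat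
  have hlim : Filter.Tendsto (fun k : ℕ => 1 / ((k : ℝ) + 1)) Filter.atTop (𝓝 0) :=
    tendsto_one_div_add_atTop_nhds_zero_nat
  have happrox (i : ι) : Filter.Tendsto (fun k => φ i (a k)) Filter.atTop (𝓝 (f i)) :=
    tendsto_iff_norm_sub_tendsto_zero.2 <|
      squeeze_zero (fun _ => norm_nonneg _) (fun k => ha k i) hlim
  have hcauchy : CauchySeq a := by
    refine cauchySeq_of_le_tendsto_0 (fun k : ℕ => 1 / ((k : ℝ) + 1) + 1 / (k + 1))
      (fun k l N hk hl => ?_) (by simpa using hlim.add hlim)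
    rw [dist_eq_norm]
    refine hφ _ _ (by positivity) fun i => ?_
    rw [map_sub, ← sub_sub_sub_cancel_right _ _ (f i)]
    exact (norm_sub_le _ _).trans (add_le_add
      ((ha k i).trans (Nat.one_div_le_one_div hk)) ((ha l i).trans (Nat.one_div_le_one_div hl)))
  obtain ⟨a', ha'⟩ := cauchySeq_tendsto_of_complete hcauchy
  have hcont (i : ι) : Continuous (φ i) :=
    AddMonoidHomClass.continuous_of_bound (φ i) 1 fun b => by
      simpa using NonUnitalStarAlgHom.norm_apply_le (φ i) b
  exact ⟨a', fun i => tendsto_nhds_unique (((hcont i).tendsto a').comp ha') (happrox i)⟩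

namespace Frame

section Subalgebra

variable {A : Type u} [NonUnitalCStarAlgebra A] {T : Type*} [TopologicalSpace T] [T2Space T]
  {θ : T ≃ₜ PrimitiveSpectrum A} {n : ℕ} {B : NonUnitalStarSubalgebra ℂ A} {E : A →ₗ[ℂ] A}
  (hn : 1 ≤ n) (hA : IsHomogeneous A n) (hB : IsMasa B) (hE : IsConditionalExpectation B E)

include hn hA hB hE

theorem norm_le_of_forall_hom {a : A} {c : ℝ} (hc : 0 ≤ c)
    (h : ∀ x : Frame θ n B, ‖x.hom a‖ ≤ c) : ‖a‖ ≤ c := by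
  refine MatrixRep.norm_le_of_forall_hom (θ := θ) hn hA hc fun x => ?_
  obtain ⟨y, hy⟩ := exists_base_eq (θ := θ) hn hA hB hE x.base
  rw [← MatrixRep.norm_eq (x := y.toMatrixRep) hA hy]
  exact h y

theorem eq_of_forall_hom {a b : A} (h : ∀ x : Frame θ n B, x.hom a = x.hom b) : a = b := by
  rw [← sub_eq_zero, ← norm_le_zero_iff]
  exact norm_le_of_forall_hom (θ := θ) hn hA hB hE le_rfl fun x => by
    rw [map_sub, h, sub_self, norm_zero]

theorem mem_iff_forall_hom_mem_diag (θ : T ≃ₜ PrimitiveSpectrum A) (a : A) :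
    a ∈ B ↔ ∀ x : Frame θ n B, x.hom a ∈ diag n := by
  refine ⟨fun ha x => x.image_eq ▸ ⟨a, ha, rfl⟩, fun h => hB.mem_of_forall_mul_comm fun b hb =>
    eq_of_forall_hom (θ := θ) hn hA hB hE fun x => ?_⟩
  have hxb : x.hom b ∈ diag n := x.image_eq ▸ ⟨b, hb, rfl⟩
  rw [map_mul, map_mul, mul_comm_of_mem_diag hxb (h x)]

theorem isOpenMap_base : IsOpenMap (base : Frame θ n B → T) := by
  rw [isOpenMap_iff_nhds_le]
  intro x
  obtain ⟨e, he, -⟩ := (isPrincipalBundle_frameProj hn hA θ hB hE).locallyTrivial x.base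
  exact (e.map_proj_nhds (e.mem_source.2 he)).ge

end Subalgebra

section EquivariantMaps

variable {A₁ A₂ : Type u} [NonUnitalCStarAlgebra A₁] [NonUnitalCStarAlgebra A₂] {T₁ T₂ : Type*}
  [TopologicalSpace T₁] [TopologicalSpace T₂] {θ₁ : T₁ ≃ₜ PrimitiveSpectrum A₁}
  {θ₂ : T₂ ≃ₜ PrimitiveSpectrum A₂} {n : ℕ} {B₁ : NonUnitalStarSubalgebra ℂ A₁}
  {B₂ : NonUnitalStarSubalgebra ℂ A₂} {G : Frame θ₁ n B₁ → Frame θ₂ n B₂}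

theorem norm_hom_sub_eq (hsmul : ∀ (g : autMD n) x, G (g • x) = g • G x) {x x' : Frame θ₁ n B₁}
    (h : x.base = x'.base) (a : A₁) (b : A₂) :
    ‖x.hom a - (G x).hom b‖ = ‖x'.hom a - (G x').hom b‖ := by
  obtain ⟨g, rfl⟩ := exists_smul_eq h
  rw [hsmul, smul_hom_apply, smul_hom_apply, ← map_sub, StarAlgEquiv.norm_map]

variable [T2Space T₁] {f : T₁ ≃ₜ T₂} {E : A₁ →ₗ[ℂ] A₁}
  (hn : 1 ≤ n) (hA₁ : IsHomogeneous A₁ n) (hB₁ : IsMasa B₁) (hE : IsConditionalExpectation B₁ E)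
  (hG : Continuous G) (hsmul : ∀ (g : autMD n) x, G (g • x) = g • G x)

include hn hA₁ hB₁ hE hG hsmul

theorem exists_isOpen_norm_hom_sub_lt (b : A₂) {ε : ℝ} (hε : 0 < ε) (t : T₁) :
    ∃ (a : A₁) (V : Set T₁), IsOpen V ∧ t ∈ V ∧
      ∀ x : Frame θ₁ n B₁, x.base ∈ V → ‖x.hom a - (G x).hom b‖ < ε := by
  obtain ⟨x, rfl⟩ := exists_base_eq (θ := θ₁) hn hA₁ hB₁ hE t
  obtain ⟨a, ha⟩ := x.surjective ((G x).hom b)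
  have hopen : IsOpen {y : Frame θ₁ n B₁ | ‖y.hom a - (G y).hom b‖ < ε} :=
    isOpen_lt ((continuous_hom_apply a).sub ((continuous_hom_apply b).comp hG)).norm
      continuous_const
  refine ⟨a, _, isOpenMap_base hn hA₁ hB₁ hE _ hopen, ⟨x, ?_, rfl⟩, ?_⟩
  · rwa [Set.mem_ofPred_eq, ha, sub_self, norm_zero]
  · rintro y ⟨y', hy', h⟩
    exact norm_hom_sub_eq hsmul h a b ▸ hy'

variable (hA₂ : IsHomogeneous A₂ n) (hf : ∀ x, (G x).base = f x.base)

include hA₂ hf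

/-- The equivariant map turns `b` into a continuous section of the C*-bundle of `A₁`, and the
elements of `A₁` that are close to it locally are glued by a partition of unity. -/
theorem exists_norm_hom_sub_le (b : A₂) {ε : ℝ} (hε : 0 < ε) :
    ∃ a : A₁, ∀ x : Frame θ₁ n B₁, ‖x.hom a - (G x).hom b‖ ≤ ε := by
  choose a V hV hVt ha using exists_isOpen_norm_hom_sub_lt hn hA₁ hB₁ hE hG hsmul b hε
  let K : Set T₁ := f.symm '' (MatrixRep.base '' {x : MatrixRep θ₂ n | ε ≤ ‖x.hom b‖})
  have hK : IsCompact K :=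
    ((MatrixRep.isCompact_le_norm hA₂ b hε).image MatrixRep.continuous_base).image f.symm.continuous
  have hKc (x : Frame θ₁ n B₁) (hx : x.base ∉ K) : ‖(G x).hom b‖ ≤ ε := by
    refine le_of_not_ge fun h => hx ⟨(G x).base, ⟨(G x).toMatrixRep, h, rfl⟩, ?_⟩
    rw [hf, f.symm_apply_apply]
  obtain ⟨s, z, c, hz, hc0, hcV, hc1, hcK⟩ := exists_partition θ₁ hn hA₁ hK hV hVt
  refine ⟨∑ t ∈ s, z t * a t, fun x => ?_⟩
  have hsum : x.hom (∑ t ∈ s, z t * a t) = ∑ t ∈ s, c t x.base • x.hom (a t) := by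
    rw [map_sum]
    exact Finset.sum_congr rfl fun t _ => (hz t).hom_mul x.toMatrixRep (a t)
  rw [hsum]
  refine norm_sum_smul_sub_le (fun t _ => hc0 t _) (hc1 _) (fun t _ => ?_) ?_
  · by_cases hx : x.base ∈ V t
    · exact .inr (ha t x hx).le
    · exact .inl (hcV t _ hx)
  · by_cases hx : x.base ∈ K
    · exact .inl (hcK _ hx)
    · exact .inr (hKc x hx)

theorem exists_starAlgHom_hom_eq_comp :
    ∃ Φ : A₂ →⋆ₙₐ[ℂ] A₁, ∀ b (x : Frame θ₁ n B₁), x.hom (Φ b) = (G x).hom b := by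
  choose Φ hΦ using fun b => exists_forall_apply_eq (φ := fun x : Frame θ₁ n B₁ => x.hom)
    (f := fun x => (G x).hom b)
    (fun _ _ hc h => norm_le_of_forall_hom (θ := θ₁) hn hA₁ hB₁ hE hc h)
    fun _ hε => exists_norm_hom_sub_le hn hA₁ hB₁ hE hG hsmul hA₂ hf b hε
  have heq {a b : A₁} (h : ∀ x : Frame θ₁ n B₁, x.hom a = x.hom b) : a = b :=
    eq_of_forall_hom hn hA₁ hB₁ hE h
  exact ⟨{  toFun := Φ
            map_smul' := fun c a => heq fun x => by
              rw [hΦ, map_smul, MonoidHom.id_apply, map_smul, hΦ]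
            map_zero' := heq fun x => by rw [hΦ, map_zero, map_zero]
            map_add' := fun a b => heq fun x => by rw [hΦ, map_add, map_add, hΦ, hΦ]
            map_mul' := fun a b => heq fun x => by rw [hΦ, map_mul, map_mul, hΦ, hΦ]
            map_star' := fun a => heq fun x => by rw [hΦ, map_star, map_star, hΦ] }, hΦ⟩

end EquivariantMaps

end Frame

theorem PrincipalBundleIso.pairIso {A₁ A₂ : Type u} [NonUnitalCStarAlgebra A₁]
    [NonUnitalCStarAlgebra A₂] {T₁ T₂ : Type*} [TopologicalSpace T₁] [TopologicalSpace T₂]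
    [T2Space T₁] [T2Space T₂] {n : ℕ} (hn : 1 ≤ n) (hA₁ : IsHomogeneous A₁ n)
    (hA₂ : IsHomogeneous A₂ n) {θ₁ : T₁ ≃ₜ PrimitiveSpectrum A₁} {θ₂ : T₂ ≃ₜ PrimitiveSpectrum A₂}
    {B₁ : NonUnitalStarSubalgebra ℂ A₁} {B₂ : NonUnitalStarSubalgebra ℂ A₂}
    (hB₁ : IsMasa B₁) (hB₂ : IsMasa B₂) {E₁ : A₁ →ₗ[ℂ] A₁} {E₂ : A₂ →ₗ[ℂ] A₂}
    (hE₁ : IsConditionalExpectation B₁ E₁) (hE₂ : IsConditionalExpectation B₂ E₂)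
    (h : PrincipalBundleIso (autMD n) (frameProj θ₁ n B₁) (frameProj θ₂ n B₂)) :
    PairIso B₁ B₂ := by
  obtain ⟨F, f, hf, hF⟩ := h
  have hf' (y : Frame θ₂ n B₂) : (F.symm y).base = f.symm y.base := by
    rw [f.eq_symm_apply]
    exact (hf (F.symm y)).symm.trans (congrArg Frame.base (F.apply_symm_apply y))
  have hF' (g : autMD n) (y : Frame θ₂ n B₂) : F.symm (g • y) = g • F.symm y := by
    rw [F.symm_apply_eq, hF, F.apply_symm_apply]
  obtain ⟨Φ, hΦ⟩ :=
    Frame.exists_starAlgHom_hom_eq_comp hn hA₂ hB₂ hE₂ F.symm.continuous hF' hA₁ hf'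
  obtain ⟨Ψ, hΨ⟩ := Frame.exists_starAlgHom_hom_eq_comp hn hA₁ hB₁ hE₁ F.continuous hF hA₂ hf
  have hΨΦ (a : A₁) : Ψ (Φ a) = a :=
    Frame.eq_of_forall_hom (θ := θ₁) hn hA₁ hB₁ hE₁ fun x => by rw [hΨ, hΦ, F.symm_apply_apply]
  have hΦΨ (a : A₂) : Φ (Ψ a) = a :=
    Frame.eq_of_forall_hom (θ := θ₂) hn hA₂ hB₂ hE₂ fun x => by rw [hΦ, hΨ, F.apply_symm_apply]
  have hmem (a : A₁) : Φ a ∈ B₂ ↔ a ∈ B₁ := by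
    rw [Frame.mem_iff_forall_hom_mem_diag hn hA₁ hB₁ hE₁ θ₁,
      Frame.mem_iff_forall_hom_mem_diag hn hA₂ hB₂ hE₂ θ₂, F.symm.surjective.forall]
    simp only [hΦ]
  refine ⟨.ofBijective Φ ⟨Function.LeftInverse.injective hΨΦ,
    Function.RightInverse.surjective hΦΨ⟩, Set.Subset.antisymm ?_ fun b hb => ?_⟩
  · exact Set.image_subset_iff.2 fun a ha => (hmem a).2 ha
  · exact ⟨Ψ b, (hmem _).1 ((hΦΨ b).symm ▸ hb), hΦΨ b⟩

end Reconstruction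

end HomCartan

end

theorem proposition2p3_general {A₁ A₂ : Type u} [NonUnitalCStarAlgebra A₁]
    [NonUnitalCStarAlgebra A₂] {T₁ T₂ : Type v} [TopologicalSpace T₁] [TopologicalSpace T₂]
    [T2Space T₁] [T2Space T₂] {n : ℕ} (hn : 1 ≤ n) (hA₁ : HomCartan.IsHomogeneous A₁ n)
    (hA₂ : HomCartan.IsHomogeneous A₂ n) (θ₁ : T₁ ≃ₜ HomCartan.PrimitiveSpectrum A₁)
    (θ₂ : T₂ ≃ₜ HomCartan.PrimitiveSpectrum A₂) {B₁ : NonUnitalStarSubalgebra ℂ A₁}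
    {B₂ : NonUnitalStarSubalgebra ℂ A₂} (hB₁ : HomCartan.IsMasa B₁) (hB₂ : HomCartan.IsMasa B₂)
    {E₁ : A₁ →ₗ[ℂ] A₁} {E₂ : A₂ →ₗ[ℂ] A₂} (hE₁ : HomCartan.IsConditionalExpectation B₁ E₁)
    (hE₂ : HomCartan.IsConditionalExpectation B₂ E₂) :
    HomCartan.IsPrincipalBundle (HomCartan.autMD n) (HomCartan.frameProj θ₁ n B₁) ∧
    HomCartan.IsPrincipalBundle (HomCartan.autMD n) (HomCartan.frameProj θ₂ n B₂) ∧
    (HomCartan.PairIso B₁ B₂ ↔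
      HomCartan.PrincipalBundleIso (HomCartan.autMD n)
        (HomCartan.frameProj θ₁ n B₁) (HomCartan.frameProj θ₂ n B₂)) :=
  ⟨HomCartan.isPrincipalBundle_frameProj hn hA₁ θ₁ hB₁ hE₁,
    HomCartan.isPrincipalBundle_frameProj hn hA₂ θ₂ hB₂ hE₂,
    fun h => h.principalBundleIso θ₁ θ₂ n, fun h => h.pairIso hn hA₁ hA₂ hB₁ hB₂ hE₁ hE₂⟩

theorem proposition2p3 {A : Type u} [NonUnitalCStarAlgebra A]
    {T : Type v} [TopologicalSpace T] [T2Space T] [LocallyCompactSpace T]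
    {n : ℕ} (hn : 1 ≤ n) (hA : HomCartan.IsHomogeneous A n)
    (θ : T ≃ₜ HomCartan.PrimitiveSpectrum A)
    (B₁ B₂ : NonUnitalStarSubalgebra ℂ A)
    (hB₁ : HomCartan.IsCartanSubalgebra B₁) (hB₂ : HomCartan.IsCartanSubalgebra B₂) :
    HomCartan.IsPrincipalBundle (HomCartan.autMD n) (HomCartan.frameProj θ n B₁) ∧
    HomCartan.IsPrincipalBundle (HomCartan.autMD n) (HomCartan.frameProj θ n B₂) ∧
    (HomCartan.PairIso B₁ B₂ ↔
      HomCartan.PrincipalBundleIso (HomCartan.autMD n)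
        (HomCartan.frameProj θ n B₁) (HomCartan.frameProj θ n B₂)) :=
  let ⟨_, hE₁, _⟩ := hB₁.expectation
  let ⟨_, hE₂, _⟩ := hB₂.expectation
  proposition2p3_general hn hA hA θ θ hB₁.isMasa hB₂.isMasa hE₁ hE₂
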